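/- Let $(\Omega,\mathcal F,\mathbb P)$ be a $\sigma$-finite measure space with a measurable flow $(\theta_s)_{s\in\mathbb R}$, that is, $(\omega,s)\mapsto\theta_s\omega$ is measurable, $\theta_0=\mathrm{id}$ and $\theta_s\circ\theta_t=\theta_{s+t}$. Assume that $\mathbb P$ is stationary ($\mathbb P\circ\theta_s=\mathbb P$ for all $s$) and ergodic (every $A\in\mathcal F$ with $\theta_sA=A$ for all $s$ satisfies $\mathbb P(A)=0$ or $\mathbb P(A^c)=0$). Let $\xi,\eta$ be random measures on $\mathbb R$, that is, kernels from $\Omega$ to $\mathbb R$ that are finite on compact sets for $\mathbb P$-a.e. $\omega$; atoms are allowed in both. Assume that they are invariant: for $\mathbb P$-a.e. $\omega$, $\xi(\theta_t\omega,C-t)=\xi(\omega,C)$ for all $t\in\mathbb R$ and all Borel sets $C$, and likewise for $\eta$. Assume that $\xi(\omega,\cdot)$ and $\eta(\omega,\cdot)$ are mutually singular for $\mathbb P$-a.e. $\omega$, and that the intensities are finite and equal: $\int\xi(\omega,[0,1])\,\mathbb P(d\omega)=\int\eta(\omega,[0,1])\,\mathbb P(d\omega)<\infty$. Assume finally that $\xi(\omega,\mathbb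 R)\in\{0,\infty\}$ for $\mathbb P$-a.e. $\omega$ (this holds automatically if $\mathbb P$ is finite or, more generally, if the flow is conservative). For $u\in[0,1]$ and $s\in\mathbb R$ put, with $\inf\emptyset=\infty$, $$\tau^u(s)=\inf\{t>s:\ u\,\xi\{s\}+\xi(s,t)\le\eta[s,t]\}.$$ Then $$K(s,C)=\int_0^1\mathbf 1\{\tau^u(s)\in C\}\,du,\qquad s\in\mathbb R,\ C\in\mathcal B(\mathbb R),$$ defines a transport kernel (a sub-Markovian kernel from $\Omega\times\mathbb R$ to $\mathbb R$; the formula is used for all $\omega$ for which $\xi(\omega,\cdot)$ and $\eta(\omega,\cdot)$ are finite on compact sets, and $K$ is suitably chosen on the remaining $\mathbb P$-null set of $\omega$), and $K$ balances $\xi$ and $\eta$: $K(\omega,s,\mathbb R)=1$ for a.e. $(\omega,s)$ with respect to $\xi(\omega,ds)\,\mathbb P(d\omega)$, and $\int K(\omega,s,\cdot)\,\xi(\omega,ds)=\eta(\omega,\cdot)$ for $\mathbb P$-a.e. $\omega$. -/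

import Mathlib

open MeasureTheory ProbabilityTheory Set
open scoped ENNReal

noncomputable section

namespace RandomTransport

/-- A measurable flow `(θ_s)_{s ∈ ℝ}` on a measurable space `Ω`. -/
structure MeasurableFlow (Ω : Type*) [MeasurableSpace Ω] where
  /-- The map `θ_s` of the flow. -/
  toFun : ℝ → Ω → Ω
  measurable' : Measurable (fun p : Ω × ℝ => toFun p.2 p.1)
  zero' : toFun 0 = id
  comp' : ∀ s t : ℝ, toFun s ∘ toFun t = toFun (s + t)

instance {Ω : Type*} [MeasurableSpace Ω] :
    CoeFun (MeasurableFlow Ω) (fun _ => ℝ → Ω → Ω) := ⟨MeasurableFlow.toFun⟩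

section Flow

variable {Ω : Type*} [MeasurableSpace Ω]

/-- `P` is stationary under the flow: every `θ_s` preserves `P`. -/
def IsStationary (θ : MeasurableFlow Ω) (P : Measure Ω) : Prop :=
  ∀ s : ℝ, MeasurePreserving (θ s) P P

/-- `A` belongs to the invariant `σ`-field: it is measurable and `θ_s A = A` for all `s`. -/
def IsInvariantSet (θ : MeasurableFlow Ω) (A : Set Ω) : Prop :=
  MeasurableSet A ∧ ∀ s : ℝ, θ s '' A = A

/-- `P` is ergodic under the flow: every invariant set is `P`-null or has `P`-null complement. -/
def IsErgodic (θ : MeasurableFlow Ω) (P : Measure Ω) : Prop :=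
  ∀ A : Set Ω, IsInvariantSet θ A → P A = 0 ∨ P Aᶜ = 0

/-- A measure on `ℝ` that is finite on all compact sets. -/
def FiniteOnCompacts (μ : Measure ℝ) : Prop :=
  ∀ C : Set ℝ, IsCompact C → μ C < ∞

/-- A random measure on `ℝ`: a kernel from `Ω` to `ℝ` which is finite on compact sets for
`P`-almost every `ω`. -/
def IsRandomMeasure (P : Measure Ω) (ξ : Kernel Ω ℝ) : Prop :=
  ∀ᵐ ω ∂P, FiniteOnCompacts (ξ ω)

/-- Invariance (flow-adaptedness) of a kernel: for `P`-almost every `ω`,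
`ξ(θ_t ω, C - t) = ξ(ω, C)` for all `t` and all Borel sets `C`. -/
def IsInvariantKernel (θ : MeasurableFlow Ω) (P : Measure Ω) (ξ : Kernel Ω ℝ) : Prop :=
  ∀ᵐ ω ∂P, ∀ (t : ℝ) (C : Set ℝ), MeasurableSet C →
    ξ (θ t ω) ((fun x => x - t) '' C) = ξ ω C

/-- The intensity `E ξ[0,1]`. -/
def intensity (P : Measure Ω) (ξ : Kernel Ω ℝ) : ℝ≥0∞ :=
  ∫⁻ ω, ξ ω (Icc 0 1) ∂P

/-- Mutual singularity of two random measures: `ξ(ω)` and `η(ω)` are mutually singular for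
`P`-almost every `ω`. -/
def AEMutuallySingular (P : Measure Ω) (ξ η : Kernel Ω ℝ) : Prop :=
  ∀ᵐ ω ∂P, ξ ω ⟂ₘ η ω

/-- A transport kernel: a sub-Markovian kernel from `Ω × ℝ` to `ℝ`. -/
def IsTransportKernel (K : Kernel (Ω × ℝ) ℝ) : Prop :=
  ∀ p : Ω × ℝ, K p univ ≤ 1

/-- `K` balances `ξ` and `η`: `K(ω, s, ℝ) = 1` for almost every `(ω, s)` with respect to
`ξ(ω, ds) P(dω)`, and `∫ K(ω, s, ·) ξ(ω, ds) = η(ω, ·)` for `P`-almost every `ω`. -/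
def Balances (P : Measure Ω) (K : Kernel (Ω × ℝ) ℝ) (ξ η : Kernel Ω ℝ) : Prop :=
  (∀ᵐ ω ∂P, ∀ᵐ s ∂(ξ ω), K (ω, s) univ = 1) ∧
  ∀ᵐ ω ∂P, ∀ C : Set ℝ, MeasurableSet C → ∫⁻ s, K (ω, s) C ∂(ξ ω) = η ω C

end Flow

/-- `inf {t > s : u μ{s} + μ(s,t) ≤ ν[s,t]}`, an element of `ℝ ∪ {∞}`; the infimum is taken in
the extended reals, so that it is `∞` if there is no such `t`. -/
def tau (μ ν : Measure ℝ) (u s : ℝ) : EReal :=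
  sInf (Real.toEReal ''
    {t : ℝ | s < t ∧ ENNReal.ofReal u * μ {s} + μ (Ioo s t) ≤ ν (Icc s t)})

/-- `∫₀¹ 1{tau μ ν u s ∈ C} du` for a set `C` of real numbers (the value `∞` is in no such set). -/
def matchingMass (μ ν : Measure ℝ) (s : ℝ) (C : Set ℝ) : ℝ≥0∞ :=
  ∫⁻ u in Icc (0 : ℝ) 1, (Real.toEReal '' C).indicator (fun _ => (1 : ℝ≥0∞)) (tau μ ν u s)

end RandomTransport

end

/-!
Lay the line out so that an atom of `ξ` or `η` becomes an interval as long as its mass. The excess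
of `ξ` over `η` is then a function of slope `±1` (the two measures are mutually singular), and a
piece of `ξ`-mass is matched with the first later point where `η` has made up for it. Fix `b` and
let `height t = ξ[t,b] - η(t,b]`. A piece of `ξ`-mass in `[a,b]` is not matched within `[a,b]` iff
it is a strict record of `height`, seen from `b` to the left. Running suprema grow only at records,
and there they grow exactly as fast as the `ξ`-mass, so the unmatched mass is
`maxHeight a b = sup_{a ≤ t ≤ b} (ξ[t,b] - η(t,b])`: this is `lintegral_volume_height_lt` for finite
measures and `setLIntegral_unmatched` on `[a,b]`. It is proved without changing the time scale, by
comparing `ξ` with the Stieltjes measure of the running supremum.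

This formula gives two facts about a single pair of measures. The mass transported to `(a,b]` is at
most `η(a,b]` (`lintegral_matchingMass_Ioc_le`), and if some `ξ`-mass to the left of `m` is never
matched, then all of the `η`-mass to the right of `m` is used (`lintegral_matchingMass_Ioc_eq`).

For the random measures, the mass-transport principle (`lintegral_transported_eq`) and the equality
of the intensities show that almost surely no `ξ`-mass escapes iff almost surely all `η`-mass is
used. By ergodicity the only other possibility is that almost surely both fail. Then the unmatched
`ξ`-mass lies to the right of the unmatched `η`-mass and has a finite leftmost position, which is
equivariant. The flow is then dissipative, and mass transport shows that `ξ` has finite total mass,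
hence mass `0`, which is absurd (`measure_eq_zero_of_escaping`).
-/

namespace RandomTransport

open Filter Topology

set_option linter.unusedSectionVars false

/-! ### Measures on the line determined by their values on half-open intervals -/

lemma exists_measureReal_lt_of_iInter_eq_empty {α : Type*} [MeasurableSpace α] {μ : Measure α}
    {F : ℕ → Set α} (hm : ∀ n, MeasurableSet (F n)) (ha : Antitone F) (hf : μ (F 0) ≠ ∞)
    (he : ⋂ n, F n = ∅) {ε : ℝ} (hε : 0 < ε) : ∃ n, μ.real (F n) < ε := by
  have h := tendsto_measure_iInter_atTop (μ := μ) (fun n => (hm n).nullMeasurableSet) ha ⟨0, hf⟩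
  rw [he, measure_empty] at h
  have h2 := (ENNReal.tendsto_toReal ENNReal.zero_ne_top).comp h
  exact (h2.eventually (gt_mem_nhds (by simpa using hε))).exists

lemma tendsto_measureReal_Ico_left (μ : Measure ℝ) [IsLocallyFiniteMeasure μ] (t : ℝ) :
    Tendsto (fun s => μ.real (Ico s t)) (𝓝[<] t) (𝓝 0) := by
  obtain ⟨u, hu, hut, hlim⟩ := exists_seq_strictMono_tendsto t
  have key : ∀ ε > 0, ∃ n, μ.real (Ico (u n) t) < ε := fun ε hε =>
    exists_measureReal_lt_of_iInter_eq_empty (fun _ => measurableSet_Ico)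
      (fun i j hij => Ico_subset_Ico_left (hu.monotone hij)) measure_Ico_lt_top.ne
      (by
        ext x
        simp only [mem_iInter, mem_Ico, mem_empty_iff_false, iff_false, not_forall]
        by_contra! hx
        exact absurd (le_of_tendsto' hlim fun n => (hx n).1) (not_le.2 (hx 0).2)) hε
  refine tendsto_order.2 ⟨fun a ha => Eventually.of_forall fun s => ha.trans_le measureReal_nonneg,
    fun ε hε => ?_⟩
  obtain ⟨n, hn⟩ := key ε hε
  filter_upwards [Ioo_mem_nhdsLT (hut n)] with s hs
  exact (measureReal_mono (Ico_subset_Ico_left hs.1.le) measure_Ico_lt_top.ne).trans_lt hn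

lemma tendsto_measureReal_Ioc_right (μ : Measure ℝ) [IsLocallyFiniteMeasure μ] (s : ℝ) :
    Tendsto (fun t => μ.real (Ioc s t)) (𝓝[>] s) (𝓝 0) := by
  obtain ⟨u, hu, hut, hlim⟩ := exists_seq_strictAnti_tendsto s
  have key : ∀ ε > 0, ∃ n, μ.real (Ioc s (u n)) < ε := fun ε hε =>
    exists_measureReal_lt_of_iInter_eq_empty (fun _ => measurableSet_Ioc)
      (fun i j hij => Ioc_subset_Ioc_right (hu.antitone hij)) measure_Ioc_lt_top.ne
      (by
        ext x
        simp only [mem_iInter, mem_Ioc, mem_empty_iff_false, iff_false, not_forall]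
        by_contra! hx
        exact absurd (ge_of_tendsto' hlim fun n => (hx n).2) (not_le.2 (hx 0).1)) hε
  refine tendsto_order.2 ⟨fun a ha => Eventually.of_forall fun s => ha.trans_le measureReal_nonneg,
    fun ε hε => ?_⟩
  obtain ⟨n, hn⟩ := key ε hε
  filter_upwards [Ioo_mem_nhdsGT (hut n)] with t ht
  exact (measureReal_mono (Ioc_subset_Ioc_right ht.2.le) measure_Ioc_lt_top.ne).trans_lt hn

lemma tendsto_measureReal_Ici_atTop (μ : Measure ℝ) [IsFiniteMeasure μ] :
    Tendsto (fun s => μ.real (Ici s)) atTop (𝓝 0) := by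
  refine tendsto_order.2 ⟨fun a ha => Eventually.of_forall fun s => ha.trans_le measureReal_nonneg,
    fun ε hε => ?_⟩
  obtain ⟨n, hn⟩ := exists_measureReal_lt_of_iInter_eq_empty (μ := μ)
    (F := fun n : ℕ => Ici (n : ℝ)) (fun _ => measurableSet_Ici)
    (fun i j hij => Ici_subset_Ici.2 (by exact_mod_cast hij)) (measure_ne_top _ _)
    (by
      ext x
      obtain ⟨n, hn⟩ := exists_nat_gt x
      simpa using ⟨n, hn⟩) hε
  filter_upwards [eventually_ge_atTop (n : ℝ)] with s hs
  exact (measureReal_mono (Ici_subset_Ici.2 hs)).trans_lt hn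

/-- A nonincreasing left-continuous function is the tail of a measure, up to a constant. -/
lemma exists_measure_Ico_eq_of_antitone {V : ℝ → ℝ} (hV : Antitone V)
    (hl : ∀ t, Tendsto V (𝓝[<] t) (𝓝 (V t))) :
    ∃ ρ : Measure ℝ, ∀ s t, ρ (Ico s t) = ENNReal.ofReal (V s - V t) := by
  have hm : Monotone (fun x => - V x) := fun x y h => neg_le_neg (hV h)
  have hleft : ∀ t, Function.leftLim hm.stieltjesFunction t = - V t := by
    intro t
    have h1 : Function.leftLim (fun x => - V x) t = - V t :=
      leftLim_eq_of_tendsto (hl t).neg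
    have : (hm.stieltjesFunction : ℝ → ℝ) = Function.rightLim (fun x => - V x) := rfl
    rw [this, leftLim_rightLim (hm.tendsto_leftLim t), h1]
  refine ⟨hm.stieltjesFunction.measure, fun s t => ?_⟩
  rw [StieltjesFunction.measure_Ico, hleft, hleft]
  congr 1
  ring

lemma measureReal_Ico_add_Ici (μ : Measure ℝ) [IsFiniteMeasure μ] {s t : ℝ} (h : s ≤ t) :
    μ.real (Ici s) = μ.real (Ico s t) + μ.real (Ici t) := by
  rw [← measureReal_union ?_ measurableSet_Ici, Ico_union_Ici_eq_Ici h]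
  exact Set.disjoint_left.2 fun x hx hx' => not_le.2 hx.2 hx'

lemma measureReal_Ioc_add_Ioi (μ : Measure ℝ) [IsFiniteMeasure μ] {s t : ℝ} (h : s ≤ t) :
    μ.real (Ioi s) = μ.real (Ioc s t) + μ.real (Ioi t) := by
  rw [← measureReal_union ?_ measurableSet_Ioi, Ioc_union_Ioi_eq_Ioi h]
  exact Set.disjoint_left.2 fun x hx hx' => not_lt.2 hx.2 hx'

lemma measure_le_of_forall_Ico_le {α β : Measure ℝ} [IsFiniteMeasure α] [IsFiniteMeasure β]
    (h : ∀ s t, s < t → α (Ico s t) ≤ β (Ico s t)) : α ≤ β := by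
  have hr : ∀ s t, s < t → α.real (Ico s t) ≤ β.real (Ico s t) := fun s t hst =>
    ENNReal.toReal_mono (measure_ne_top _ _) (h s t hst)
  set V : ℝ → ℝ := fun s => β.real (Ici s) - α.real (Ici s) with hVdef
  have hdiff : ∀ s t, s ≤ t → V s - V t = β.real (Ico s t) - α.real (Ico s t) := by
    intro s t hst
    simp only [hVdef, measureReal_Ico_add_Ici α hst, measureReal_Ico_add_Ici β hst]
    ring
  have hV : Antitone V := by
    intro s t hst
    rcases hst.eq_or_lt with rfl | hlt
    · exact le_rfl
    · linarith [hdiff s t hst, hr s t hlt]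
  have hl : ∀ t, Tendsto V (𝓝[<] t) (𝓝 (V t)) := by
    intro t
    have h0 : Tendsto (fun s => V t + (β.real (Ico s t) - α.real (Ico s t))) (𝓝[<] t)
        (𝓝 (V t + (0 - 0))) :=
      ((tendsto_measureReal_Ico_left β t).sub (tendsto_measureReal_Ico_left α t)).const_add _
    rw [sub_zero, add_zero] at h0
    refine h0.congr' ?_
    filter_upwards [self_mem_nhdsWithin] with s hs
    linarith [hdiff s t (le_of_lt hs)]
  obtain ⟨κ, hκ⟩ := exists_measure_Ico_eq_of_antitone hV hl
  have : β = α + κ := by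
    refine Measure.ext_of_Ico _ _ fun s t hst => ?_
    rw [Measure.add_apply, hκ, hdiff s t hst.le, ENNReal.ofReal_sub _ measureReal_nonneg,
      ofReal_measureReal, ofReal_measureReal, add_tsub_cancel_of_le (h s t hst)]
  rw [this]
  exact Measure.le_add_right le_rfl

/-! ### Records of the height process of two finite measures -/

/-- The excess of the `μ`-mass over the `ν`-mass to the right of `t`. An atom of `μ` at `t` is
counted and an atom of `ν` at `t` is not, so that `height` is upper semicontinuous and sees the
largest value that the excess takes while the atoms at `t` are traversed. -/
noncomputable def height (μ ν : Measure ℝ) (t : ℝ) : ℝ := μ.real (Ici t) - ν.real (Ioi t)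

/-- The running supremum of `height`, seen from the right. -/
noncomputable def record (μ ν : Measure ℝ) (s : ℝ) : ℝ := sSup (height μ ν '' Ici s)

section Record

variable {μ ν : Measure ℝ} [IsFiniteMeasure μ] [IsFiniteMeasure ν]

lemma height_sub {s t : ℝ} (h : s ≤ t) :
    height μ ν s - height μ ν t = μ.real (Ico s t) - ν.real (Ioc s t) := by
  simp only [height, measureReal_Ico_add_Ici μ h, measureReal_Ioc_add_Ioi ν h]
  ring

lemma height_le_Ici {s t : ℝ} (h : s ≤ t) : height μ ν t ≤ μ.real (Ici s) :=
  (sub_le_self _ measureReal_nonneg).trans (measureReal_mono (Ici_subset_Ici.2 h))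

lemma bddAbove_range_height : BddAbove (range (height μ ν)) :=
  ⟨μ.real univ, by
    rintro _ ⟨t, rfl⟩
    exact (height_le_Ici le_rfl).trans (measureReal_mono (subset_univ _))⟩

lemma bddAbove_height (s : ℝ) : BddAbove (height μ ν '' Ici s) :=
  bddAbove_range_height.mono (image_subset_range _ _)

lemma height_le_record {s t : ℝ} (h : s ≤ t) : height μ ν t ≤ record μ ν s :=
  le_csSup (bddAbove_height s) ⟨t, h, rfl⟩

lemma record_le {s c : ℝ} (h : ∀ t, s ≤ t → height μ ν t ≤ c) : record μ ν s ≤ c :=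
  csSup_le ⟨_, s, self_mem_Ici, rfl⟩ (by rintro _ ⟨t, ht, rfl⟩; exact h t ht)

lemma record_antitone : Antitone (record μ ν) := fun _ _ h =>
  record_le fun _ hu => height_le_record (h.trans hu)

lemma record_le_add (s t : ℝ) :
    record μ ν s ≤ record μ ν t + μ.real (Ico s t) := by
  refine record_le fun c hc => ?_
  rcases le_total t c with htc | hct
  · linarith [height_le_record (μ := μ) (ν := ν) htc,
      measureReal_nonneg (μ := μ) (s := Ico s t)]
  · have h1 := height_sub (μ := μ) (ν := ν) hct
    have h2 := height_le_record (μ := μ) (ν := ν) (le_refl t)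
    have h3 : μ.real (Ico c t) ≤ μ.real (Ico s t) := measureReal_mono (Ico_subset_Ico_left hc)
    linarith [measureReal_nonneg (μ := ν) (s := Ioc c t)]

/-- A record at `s` that is set before `t` exceeds the height at `s` by at most the `ν`-mass in
between, since only `ν` makes the height increase. -/
lemma record_le_max {s t : ℝ} :
    record μ ν s ≤ max (record μ ν t) (height μ ν s + ν.real (Ioc s t)) := by
  refine record_le fun c hc => ?_
  rcases le_total t c with htc | hct
  · exact le_max_of_le_left (height_le_record htc)
  · refine le_max_of_le_right ?_
    have h1 := height_sub (μ := μ) (ν := ν) hc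
    have h3 : ν.real (Ioc s c) ≤ ν.real (Ioc s t) := measureReal_mono (Ioc_subset_Ioc_right hct)
    linarith [measureReal_nonneg (μ := μ) (s := Ico s c)]

lemma tendsto_record_left (t : ℝ) :
    Tendsto (record μ ν) (𝓝[<] t) (𝓝 (record μ ν t)) := by
  have h0 : Tendsto (fun s => record μ ν t + μ.real (Ico s t)) (𝓝[<] t)
      (𝓝 (record μ ν t + 0)) := (tendsto_measureReal_Ico_left μ t).const_add _
  rw [add_zero] at h0
  refine tendsto_of_tendsto_of_tendsto_of_le_of_le' tendsto_const_nhds h0 ?_ ?_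
  · filter_upwards [self_mem_nhdsWithin] with s hs using record_antitone (le_of_lt hs)
  · filter_upwards [self_mem_nhdsWithin] with s hs using record_le_add s t

lemma tendsto_record_atTop : Tendsto (record μ ν) atTop (𝓝 0) := by
  refine tendsto_of_tendsto_of_tendsto_of_le_of_le (g := fun s => - ν.real (Ici s))
    (by simpa using (tendsto_measureReal_Ici_atTop ν).neg) (tendsto_measureReal_Ici_atTop μ)
    (fun s => ?_) (fun s => record_le fun t ht => height_le_Ici ht)
  have h1 : height μ ν s ≤ record μ ν s := height_le_record le_rfl
  have h2 : ν.real (Ioi s) ≤ ν.real (Ici s) := measureReal_mono Ioi_subset_Ici_self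
  have h3 : 0 ≤ μ.real (Ici s) := measureReal_nonneg
  simp only [height] at h1
  linarith

lemma tendsto_record_atBot :
    Tendsto (record μ ν) atBot (𝓝 (sSup (range (height μ ν)))) := by
  refine tendsto_order.2 ⟨fun a ha => ?_, fun a ha => Eventually.of_forall fun s =>
    (record_le fun t _ => le_csSup bddAbove_range_height ⟨t, rfl⟩).trans_lt ha⟩
  obtain ⟨_, ⟨t, rfl⟩, ht⟩ := exists_lt_of_lt_csSup (range_nonempty _) ha
  filter_upwards [eventually_le_atBot t] with s hs using ht.trans_le (height_le_record hs)

/-- The points where the running supremum exceeds all its values further to the right. -/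
def strictRecords (μ ν : Measure ℝ) : Set ℝ := {s | ∀ t, s < t → record μ ν t < record μ ν s}

lemma record_eq_height_of_mem {s : ℝ} (hs : s ∈ strictRecords μ ν) :
    record μ ν s = height μ ν s := by
  refine le_antisymm ?_ (height_le_record le_rfl)
  have h0 : Tendsto (fun t => height μ ν s + ν.real (Ioc s t)) (𝓝[>] s)
      (𝓝 (height μ ν s + 0)) := (tendsto_measureReal_Ioc_right ν s).const_add _
  rw [add_zero] at h0
  refine ge_of_tendsto h0 ?_
  filter_upwards [self_mem_nhdsWithin] with t ht
  exact (le_max_iff.1 (record_le_max (t := t))).resolve_left (not_le.2 (hs t ht))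

/-- Outside the strict records the running supremum is constant up to some rational point, so that
the complement is a countable union. -/
lemma compl_strictRecords :
    (strictRecords μ ν)ᶜ = ⋃ q : ℚ, {s : ℝ | s < q ∧ record μ ν s = record μ ν q} := by
  ext s
  simp only [strictRecords, mem_compl_iff, mem_ofPred_eq, not_forall, not_lt, mem_iUnion]
  constructor
  · rintro ⟨t, hst, h⟩
    obtain ⟨q, hsq, hqt⟩ := exists_rat_btwn hst
    exact ⟨q, hsq, le_antisymm (h.trans (record_antitone hqt.le)) (record_antitone hsq.le)⟩
  · rintro ⟨q, hsq, h⟩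
    exact ⟨q, hsq, h.le⟩

lemma measurableSet_strictRecords : MeasurableSet (strictRecords μ ν) := by
  rw [← MeasurableSet.compl_iff, compl_strictRecords]
  exact MeasurableSet.iUnion fun q => measurableSet_Iio.inter
    (record_antitone.measurable (measurableSet_singleton _))

lemma measurable_height : Measurable (height μ ν) :=
  Antitone.measurable (fun _ _ h => measureReal_mono (Ici_subset_Ici.2 h)) |>.sub
    (Antitone.measurable fun _ _ h => measureReal_mono (Ioi_subset_Ioi h))

variable (μ ν) in
/-- There is a measure, dominated by `μ`, whose tails are the running suprema of `height`. -/
lemma exists_recordMeasure : ∃ ρ : Measure ℝ, IsFiniteMeasure ρ ∧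
    (∀ s t, ρ (Ico s t) = ENNReal.ofReal (record μ ν s - record μ ν t)) ∧ ρ ≤ μ ∧
    ρ univ = ENNReal.ofReal (sSup (range (height μ ν))) := by
  obtain ⟨ρ, hρ⟩ := exists_measure_Ico_eq_of_antitone (record_antitone (μ := μ) (ν := ν))
    tendsto_record_left
  have huniv : ρ univ = ENNReal.ofReal (sSup (range (height μ ν))) := by
    have h1 := tendsto_measure_iUnion_atTop (μ := ρ) (s := fun n : ℕ => Ico (-(n : ℝ)) n)
      (fun i j hij => Ico_subset_Ico (by simpa using hij) (by simpa using hij))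
    have h2 : ⋃ n : ℕ, Ico (-(n : ℝ)) n = univ := by
      refine eq_univ_of_forall fun x => mem_iUnion.2 ?_
      obtain ⟨n, hn⟩ := exists_nat_gt |x|
      exact ⟨n, (abs_lt.1 hn).1.le, (abs_lt.1 hn).2⟩
    rw [h2] at h1
    have h3 : Tendsto (fun n : ℕ => record μ ν (-(n : ℝ)) - record μ ν n) atTop
        (𝓝 (sSup (range (height μ ν)) - 0)) :=
      (tendsto_record_atBot.comp (tendsto_neg_atTop_atBot.comp tendsto_natCast_atTop_atTop)).sub
        (tendsto_record_atTop.comp tendsto_natCast_atTop_atTop)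
    rw [sub_zero] at h3
    refine tendsto_nhds_unique h1 ((ENNReal.tendsto_ofReal h3).congr fun n => ?_)
    exact (hρ _ _).symm
  have hfin : IsFiniteMeasure ρ := ⟨by rw [huniv]; exact ENNReal.ofReal_lt_top⟩
  refine ⟨ρ, hfin, hρ, measure_le_of_forall_Ico_le fun s t hst => ?_, huniv⟩
  rw [hρ, ← ofReal_measureReal]
  exact ENNReal.ofReal_le_ofReal (by linarith [record_le_add (μ := μ) (ν := ν) s t])

end Record

lemma measure_eq_zero_of_forall_Ico_eq_zero {ρ : Measure ℝ} {Z : Set ℝ} {q : ℝ}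
    (hq : ∀ s ∈ Z, s < q ∧ ρ (Ico s q) = 0) : ρ Z = 0 := by
  refine measure_null_of_locally_null Z fun x hx => ?_
  by_cases h : ∃ s ∈ Z, s < x
  · obtain ⟨s, hs, hsx⟩ := h
    exact ⟨Ico s q, mem_nhdsWithin_of_mem_nhds (Ico_mem_nhds hsx (hq x hx).1), (hq s hs).2⟩
  · push Not at h
    refine ⟨Z, self_mem_nhdsWithin, ?_⟩
    have hsub : Z ⊆ Ico x q := fun y hy => ⟨h y hy, (hq y hy).1⟩
    exact measure_mono_null hsub (hq x hx).2

section Record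

variable {μ ν ρ : Measure ℝ} [IsFiniteMeasure μ] [IsFiniteMeasure ν] [IsFiniteMeasure ρ]

lemma measure_compl_strictRecords
    (hρ : ∀ s t, ρ (Ico s t) = ENNReal.ofReal (record μ ν s - record μ ν t)) :
    ρ (strictRecords μ ν)ᶜ = 0 := by
  rw [compl_strictRecords, measure_iUnion_null_iff]
  intro q
  refine measure_eq_zero_of_forall_Ico_eq_zero (q := q) fun s hs => ⟨hs.1, ?_⟩
  rw [hρ, hs.2, sub_self, ENNReal.ofReal_zero]

/-- Away from the atoms of `μ`, the record measure dominates `μ` on the set where the height is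
a record. -/
lemma measure_inter_le_recordMeasure
    (hρ : ∀ s t, ρ (Ico s t) = ENNReal.ofReal (record μ ν s - record μ ν t))
    {B S : Set ℝ} (hB : MeasurableSet B) (hνS : ν S = 0)
    (hBS : B ⊆ S) (hatom : ∀ x ∈ B, μ {x} = 0)
    (hrec : ∀ x ∈ B, record μ ν x = height μ ν x) : μ B ≤ ρ B := by
  have hle : μ.restrict B ≤ ρ + ν := by
    refine measure_le_of_forall_Ico_le fun p q _ => ?_
    rw [Measure.restrict_apply measurableSet_Ico]
    -- inner regularity: a compact subset contains its endpoints, where the height is a record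
    refine ENNReal.le_of_forall_pos_le_add fun ε hε _ => ?_
    obtain ⟨C, hCsub, hC, hlt⟩ := (measurableSet_Ico.inter hB).exists_isCompact_lt_add
      (measure_ne_top μ (Ico p q ∩ B)) (ENNReal.coe_ne_zero.2 hε.ne')
    refine hlt.le.trans (add_le_add_left ?_ _)
    rcases C.eq_empty_or_nonempty with rfl | hne
    · simp
    have hs := hCsub (hC.sInf_mem hne)
    have ht := hCsub (hC.sSup_mem hne)
    set s := sInf C
    set t := sSup C
    have hst : s ≤ t := csInf_le_csSup hne hC.bddBelow hC.bddAbove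
    have hsub : C ⊆ Ico s t ∪ {t} := fun x hx => by
      rcases (le_csSup hC.bddAbove hx).eq_or_lt with h | h
      · exact Or.inr h
      · exact Or.inl ⟨csInf_le hC.bddBelow hx, h⟩
    calc μ C ≤ μ (Ico s t) + μ {t} := (measure_mono hsub).trans (measure_union_le _ _)
      _ = μ (Ico s t) := by rw [hatom t ht.2, add_zero]
      _ = ρ (Ico s t) + ν (Ioc s t) := by
        have h1 := height_sub (μ := μ) (ν := ν) hst
        have h2 : 0 ≤ record μ ν s - record μ ν t := sub_nonneg.2 (record_antitone hst)
        rw [hρ, ← ofReal_measureReal, ← ofReal_measureReal,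
          ← ENNReal.ofReal_add h2 measureReal_nonneg, hrec s hs.2, hrec t ht.2, h1]
        congr 1
        ring
      _ ≤ (ρ + ν) (Ico p q) := by
        rw [Measure.add_apply]
        exact add_le_add (measure_mono (Ico_subset_Ico hs.1.1 ht.1.2.le))
          (measure_mono fun x hx => ⟨hs.1.1.trans hx.1.le, hx.2.trans_lt ht.1.2⟩)
  -- `ν` is concentrated off `B`
  have := hle B
  rwa [Measure.restrict_apply_self, Measure.add_apply, measure_mono_null hBS hνS,
    add_zero] at this

lemma recordMeasure_singleton
    (hρ : ∀ s t, ρ (Ico s t) = ENNReal.ofReal (record μ ν s - record μ ν t)) (x : ℝ) :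
    ρ.real {x} = record μ ν x - Function.rightLim (record μ ν) x := by
  have h1 : Tendsto (fun t => ρ.real {x} + ρ.real (Ioc x t)) (𝓝[>] x) (𝓝 (ρ.real {x} + 0)) :=
    (tendsto_measureReal_Ioc_right ρ x).const_add _
  have h2 : Tendsto (fun t => record μ ν x - record μ ν t) (𝓝[>] x)
      (𝓝 (record μ ν x - Function.rightLim (record μ ν) x)) :=
    (record_antitone.tendsto_rightLim x).const_sub _
  rw [add_zero] at h1
  have hIco : ∀ t, x < t → ρ.real (Ico x t) = record μ ν x - record μ ν t := fun t ht => by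
    rw [Measure.real, hρ, ENNReal.toReal_ofReal (sub_nonneg.2 (record_antitone ht.le))]
  refine le_antisymm (ge_of_tendsto h2 ?_) (le_of_tendsto_of_tendsto h2 h1 ?_)
  · filter_upwards [self_mem_nhdsWithin] with t ht
    rw [← hIco t ht]
    exact measureReal_mono (singleton_subset_iff.2 ⟨le_rfl, ht⟩)
  · filter_upwards [self_mem_nhdsWithin] with t ht
    have hsub : Ico x t ⊆ {x} ∪ Ioc x t := fun y hy =>
      hy.1.eq_or_lt.imp Eq.symm fun h => ⟨h, hy.2.le⟩
    rw [← hIco t ht]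
    exact (measureReal_mono hsub).trans (measureReal_union_le _ _)

/-- At an atom `x` of `μ`, the values of `u` for which the height left over from the fraction `u`
of the atom stays a record form an interval whose length is the share of the atom that the record
measure carries. -/
lemma volume_mul_measure_singleton
    (hρ : ∀ s t, ρ (Ico s t) = ENNReal.ofReal (record μ ν s - record μ ν t)) (hρμ : ρ ≤ μ)
    {x : ℝ} (hx : 0 < μ {x}) :
    volume {u ∈ Icc (0 : ℝ) 1 | ∀ t, x < t → height μ ν t < height μ ν x - (1 - u) * μ.real {x}}
      * μ {x} = ρ {x} := by
  set G := Function.rightLim (record μ ν) x with hG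
  set m := μ.real {x} with hm
  have hm0 : 0 < m := ENNReal.toReal_pos hx.ne' (measure_ne_top _ _)
  have hρx : ρ.real {x} = record μ ν x - G := recordMeasure_singleton hρ x
  have hle : record μ ν x - G ≤ m := by
    rw [← hρx]
    exact ENNReal.toReal_mono (measure_ne_top _ _) (hρμ _)
  have hGx : 0 ≤ record μ ν x - G := by
    rw [← hρx]
    exact measureReal_nonneg
  set r := (record μ ν x - G) / m with hr
  have hr0 : 0 ≤ r := div_nonneg hGx hm0.le
  have hr1 : r ≤ 1 := (div_le_one hm0).2 hle
  have hrm : r * m = record μ ν x - G := div_mul_cancel₀ _ hm0.ne'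
  have hvol : volume {u ∈ Icc (0 : ℝ) 1 |
      ∀ t, x < t → height μ ν t < height μ ν x - (1 - u) * m} = ENNReal.ofReal r := by
    refine le_antisymm ?_ ?_
    · have hsub : {u ∈ Icc (0 : ℝ) 1 |
          ∀ t, x < t → height μ ν t < height μ ν x - (1 - u) * m} ⊆ Icc (1 - r) 1 := by
        rintro u ⟨hu, h⟩
        refine ⟨?_, hu.2⟩
        have h1 : ∀ t, x < t → record μ ν t ≤ height μ ν x - (1 - u) * m := fun t ht =>
          record_le fun c hc => (h c (ht.trans_le hc)).le
        have h2 : G ≤ height μ ν x - (1 - u) * m := by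
          refine le_of_tendsto (record_antitone.tendsto_rightLim x) ?_
          filter_upwards [self_mem_nhdsWithin] with t ht using h1 t ht
        have h3 : height μ ν x ≤ record μ ν x := height_le_record le_rfl
        have h4 : (1 - u) * m ≤ r * m := by rw [hrm]; linarith
        linarith [le_of_mul_le_mul_right h4 hm0]
      refine (measure_mono hsub).trans_eq ?_
      rw [Real.volume_Icc]
      congr 1
      ring
    · have hsub : Ioc (1 - r) 1 ⊆ {u ∈ Icc (0 : ℝ) 1 |
          ∀ t, x < t → height μ ν t < height μ ν x - (1 - u) * m} := by
        rintro u hu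
        refine ⟨⟨by linarith [hu.1], hu.2⟩, fun t ht => ?_⟩
        have hpos : 0 < r := by linarith [hu.1, hu.2]
        have hGlt : G < record μ ν x := by
          have := mul_pos hpos hm0
          linarith
        have hxN : x ∈ strictRecords μ ν := fun c hc =>
          (record_antitone.le_rightLim hc).trans_lt hGlt
        have h1 : (1 - u) * m < r * m := mul_lt_mul_of_pos_right (by linarith [hu.1]) hm0
        have h2 : height μ ν t ≤ G :=
          (height_le_record le_rfl).trans (record_antitone.le_rightLim ht)
        rw [← record_eq_height_of_mem hxN]
        linarith
      refine le_trans (le_of_eq ?_) (measure_mono hsub)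
      rw [Real.volume_Ioc]
      congr 1
      ring
  rw [hvol, ← ofReal_measureReal (μ := μ), ← hm, ← ENNReal.ofReal_mul hr0, hrm, ← hρx,
    ofReal_measureReal]

/-- The mass of `μ` that starts a record of the height process is the supremum of that process. An
atom of `μ` is split into a continuum of starting points, indexed by `u ∈ [0,1]`. -/
theorem lintegral_volume_height_lt {S : Set ℝ} (hS : MeasurableSet S) (hμS : μ Sᶜ = 0)
    (hνS : ν S = 0) :
    ∫⁻ x, volume {u ∈ Icc (0 : ℝ) 1 |
        ∀ t, x < t → height μ ν t < height μ ν x - (1 - u) * μ.real {x}} ∂μ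
      = ENNReal.ofReal (sSup (range (height μ ν))) := by
  obtain ⟨ρ, hfin, hρ, hρμ, huniv⟩ := exists_recordMeasure μ ν
  set k : ℝ → ℝ≥0∞ := fun x => volume {u ∈ Icc (0 : ℝ) 1 |
        ∀ t, x < t → height μ ν t < height μ ν x - (1 - u) * μ.real {x}} with hk
  set A : Set ℝ := {x | 0 < μ {x}} with hA
  have hAc : A.Countable := Measure.countable_meas_pos_of_disjoint_iUnion (μ := μ)
    (As := fun x : ℝ => ({x} : Set ℝ)) (fun x => measurableSet_singleton x)
    (fun x y hxy => disjoint_singleton.2 hxy)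
  have hAm : MeasurableSet A := hAc.measurableSet
  have hk1 : ∀ x, k x ≤ 1 := fun x =>
    (measure_mono (sep_subset _ _)).trans_eq (by rw [Real.volume_Icc]; simp)
  have hzero : ∀ x ∈ Aᶜ, μ {x} = 0 := fun x hx => by simpa [hA] using hx
  have hzero' : ∀ x ∈ Aᶜ, μ.real {x} = 0 := fun x hx => by simp [Measure.real, hzero x hx]
  have hatoms : ∫⁻ x in A, k x ∂μ = ρ A := by
    rw [lintegral_countable _ hAc, ← setLIntegral_one, lintegral_countable _ hAc]
    refine tsum_congr fun x => ?_
    rw [one_mul]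
    exact volume_mul_measure_singleton hρ hρμ x.2
  have hle : ∫⁻ x in Aᶜ, k x ∂μ ≤ ρ Aᶜ := by
    set E : Set ℝ := {x | record μ ν x = height μ ν x} with hE
    have hEm : MeasurableSet E := measurableSet_eq_fun record_antitone.measurable measurable_height
    have hae : (Aᶜ ∩ S : Set ℝ) =ᵐ[μ] Aᶜ := by
      refine inter_ae_eq_left_of_ae_eq_univ ?_
      rw [ae_eq_univ]
      exact hμS
    calc ∫⁻ x in Aᶜ, k x ∂μ = ∫⁻ x in Aᶜ ∩ S, k x ∂μ := (setLIntegral_congr hae).symm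
      _ ≤ ∫⁻ x in Aᶜ ∩ S, E.indicator 1 x ∂μ := by
        refine setLIntegral_mono (measurable_one.indicator hEm) fun x hx => ?_
        by_cases hxE : x ∈ E
        · rw [indicator_of_mem hxE]
          exact hk1 x
        · refine le_of_eq_of_le ?_ zero_le
          refine measure_mono_null (t := ∅) (fun u hu => hxE ?_) measure_empty
          refine le_antisymm (record_le fun t ht => ?_) (height_le_record le_rfl)
          rcases ht.eq_or_lt with rfl | hlt
          · exact le_rfl
          · have := hu.2 t hlt
            rw [hzero' x hx.1, mul_zero, sub_zero] at this
            exact this.le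
      _ = μ (E ∩ (Aᶜ ∩ S)) := by
        rw [lintegral_indicator_one hEm, Measure.restrict_apply hEm]
      _ ≤ ρ (E ∩ (Aᶜ ∩ S)) :=
        measure_inter_le_recordMeasure hρ (hEm.inter (hAm.compl.inter hS)) hνS
          (fun x hx => hx.2.2) (fun x hx => hzero x hx.2.1) (fun x hx => hx.1)
      _ ≤ ρ Aᶜ := measure_mono fun x hx => hx.2.1
  have hge : ρ Aᶜ ≤ ∫⁻ x in Aᶜ, k x ∂μ := by
    set N := strictRecords μ ν
    have hNm : MeasurableSet N := measurableSet_strictRecords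
    calc ρ Aᶜ ≤ ρ (N ∩ Aᶜ) + ρ Nᶜ := by
          refine (measure_mono fun x hx => ?_).trans (measure_union_le _ _)
          by_cases hxN : x ∈ N
          · exact Or.inl ⟨hxN, hx⟩
          · exact Or.inr hxN
      _ = ρ (N ∩ Aᶜ) := by rw [measure_compl_strictRecords hρ, add_zero]
      _ ≤ μ (N ∩ Aᶜ) := hρμ _
      _ = ∫⁻ x in Aᶜ, N.indicator 1 x ∂μ := by
        rw [lintegral_indicator_one hNm, Measure.restrict_apply hNm]
      _ ≤ ∫⁻ x in Aᶜ, k x ∂μ := by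
        refine setLIntegral_mono' hAm.compl fun x hx => ?_
        by_cases hxN : x ∈ N
        · have hfull : Icc (0 : ℝ) 1 ⊆ {u ∈ Icc (0 : ℝ) 1 |
              ∀ t, x < t → height μ ν t < height μ ν x - (1 - u) * μ.real {x}} := by
            refine fun u hu => ⟨hu, fun t ht => ?_⟩
            rw [hzero' x hx, mul_zero, sub_zero, ← record_eq_height_of_mem hxN]
            exact (height_le_record le_rfl).trans_lt (hxN t ht)
          rw [indicator_of_mem hxN, Pi.one_apply]
          refine le_of_eq_of_le ?_ (measure_mono hfull)
          rw [Real.volume_Icc]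
          simp
        · rw [indicator_of_notMem hxN]
          exact zero_le
  rw [← lintegral_add_compl k hAm, hatoms, le_antisymm hle hge, measure_add_measure_compl hAm,
    huniv]

end Record

/-! ### Joint measurability of the matching time -/

/-- Left continuity of `μ (Ioo s t)` in `t`. -/
lemma add_measure_Ioo_le_of_forall_lt {μ : Measure ℝ} {s t : ℝ} {x c : ℝ≥0∞}
    (h : ∀ t' < t, x + μ (Ioo s t') ≤ c) : x + μ (Ioo s t) ≤ c := by
  obtain ⟨u, hu, hut, hlim⟩ := exists_seq_strictMono_tendsto t
  have hU : Ioo s t = ⋃ n, Ioo s (u n) := by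
    ext y
    simp only [mem_iUnion, mem_Ioo]
    refine ⟨fun hy => ?_, fun ⟨n, hn⟩ => ⟨hn.1, hn.2.trans (hut n)⟩⟩
    obtain ⟨n, hn⟩ := (hlim.eventually (lt_mem_nhds hy.2)).exists
    exact ⟨n, hy.1, hn⟩
  have hmono : Monotone fun n => Ioo s (u n) := fun i j hij =>
    Ioo_subset_Ioo_right (hu.monotone hij)
  rw [hU, hmono.measure_iUnion, ENNReal.add_iSup]
  exact iSup_le fun n => h _ (hut n)

/-- Right continuity of `ν (Icc s t)` in `t`. -/
lemma le_measure_Icc_of_forall_gt {ν : Measure ℝ} [IsLocallyFiniteMeasure ν] {s t : ℝ} {c : ℝ≥0∞}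
    (hst : s ≤ t) (h : ∀ t', t < t' → c ≤ ν (Icc s t')) : c ≤ ν (Icc s t) := by
  have h0 : Tendsto (fun t' => ENNReal.ofReal (ν.real (Ioc t t'))) (𝓝[>] t) (𝓝 0) := by
    simpa using ENNReal.tendsto_ofReal (tendsto_measureReal_Ioc_right ν t)
  have h1 := h0.const_add (ν (Icc s t))
  rw [add_zero] at h1
  refine ge_of_tendsto h1 ?_
  filter_upwards [self_mem_nhdsWithin] with t' ht'
  rw [ofReal_measureReal measure_Ioc_lt_top.ne]
  refine (h t' ht').trans ((measure_mono ?_).trans (measure_union_le _ _))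
  rw [Icc_union_Ioc_eq_Icc hst (le_of_lt ht')]

/-- The matching condition holds somewhere on a compact interval if and only if it holds
approximately on arbitrarily short rational subintervals: the condition is upper semicontinuous
in `t`. -/
lemma exists_mem_Icc_matching_iff {μ ν : Measure ℝ} [IsLocallyFiniteMeasure ν] {s : ℝ} {a b : ℚ}
    (hsa : s < a) {x : ℝ≥0∞} :
    (∃ t ∈ Icc (a : ℝ) b, x + μ (Ioo s t) ≤ ν (Icc s t)) ↔
      ∀ n : ℕ, ∃ p q : ℚ, (a ≤ p ∧ p ≤ q ∧ q ≤ b ∧ (q : ℝ) - p ≤ 1 / ((n : ℝ) + 1)) ∧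
        x + μ (Ioo s p) ≤ ν (Icc s q) := by
  constructor
  · rintro ⟨t, ⟨hat, htb⟩, h⟩ n
    have hε : (0 : ℝ) < 1 / ((n : ℝ) + 1) := by positivity
    obtain ⟨p, hap, hpt, hp⟩ : ∃ p : ℚ, a ≤ p ∧ (p : ℝ) ≤ t ∧ t - 1 / ((n : ℝ) + 1) / 2 ≤ p := by
      rcases hat.eq_or_lt with h' | h'
      · exact ⟨a, le_rfl, hat, by rw [h']; linarith⟩
      · obtain ⟨p, h1, h2⟩ := exists_rat_btwn (max_lt h' (by linarith :
          t - 1 / ((n : ℝ) + 1) / 2 < t))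
        exact ⟨p, by exact_mod_cast (le_max_left _ _).trans h1.le, h2.le,
          (le_max_right _ _).trans h1.le⟩
    obtain ⟨q, hqb, htq, hq⟩ : ∃ q : ℚ, q ≤ b ∧ t ≤ q ∧ (q : ℝ) ≤ t + 1 / ((n : ℝ) + 1) / 2 := by
      rcases htb.eq_or_lt with h' | h'
      · exact ⟨b, le_rfl, htb, by rw [← h']; linarith⟩
      · obtain ⟨q, h1, h2⟩ := exists_rat_btwn (lt_min h' (by linarith :
          t < t + 1 / ((n : ℝ) + 1) / 2))
        exact ⟨q, by exact_mod_cast h2.le.trans (min_le_left _ _), h1.le,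
          h2.le.trans (min_le_right _ _)⟩
    refine ⟨p, q, ⟨hap, by exact_mod_cast hpt.trans htq, hqb, ?_⟩, ?_⟩
    · linarith
    · exact (add_le_add_right (measure_mono (Ioo_subset_Ioo_right hpt)) _).trans
        (h.trans (measure_mono (Icc_subset_Icc_right htq)))
  · intro h
    choose p q hpq hle using h
    have hpI : ∀ n, (p n : ℝ) ∈ Icc (a : ℝ) b := fun n =>
      ⟨by exact_mod_cast (hpq n).1, by exact_mod_cast (hpq n).2.1.trans (hpq n).2.2.1⟩
    obtain ⟨t, ht, φ, hφ, hlim⟩ := isCompact_Icc.tendsto_subseq hpI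
    refine ⟨t, ht, le_measure_Icc_of_forall_gt (hsa.le.trans ht.1) fun t'' ht'' =>
      add_measure_Ioo_le_of_forall_lt fun t' ht' => ?_⟩
    have hone : Tendsto (fun n => 1 / ((φ n : ℝ) + 1)) atTop (𝓝 0) :=
      tendsto_one_div_add_atTop_nhds_zero_nat.comp hφ.tendsto_atTop
    have hsum : Tendsto (fun n => (p (φ n) : ℝ) + 1 / ((φ n : ℝ) + 1)) atTop (𝓝 (t + 0)) :=
      hlim.add hone
    rw [add_zero] at hsum
    obtain ⟨n, hn1, hn2⟩ := ((hlim.eventually (lt_mem_nhds ht')).and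
      (hsum.eventually (gt_mem_nhds ht''))).exists
    have hq : (q (φ n) : ℝ) ≤ t'' := by
      have := (hpq (φ n)).2.2.2
      linarith
    exact (add_le_add_right (measure_mono (Ioo_subset_Ioo_right hn1.le)) _).trans
      ((hle (φ n)).trans (measure_mono (Icc_subset_Icc_right hq)))

lemma tau_lt_iff {μ ν : Measure ℝ} {u s : ℝ} {c : EReal} :
    tau μ ν u s < c ↔ ∃ a b : ℚ, s < a ∧ ((b : ℝ) : EReal) < c ∧
      ∃ t ∈ Icc (a : ℝ) b, ENNReal.ofReal u * μ {s} + μ (Ioo s t) ≤ ν (Icc s t) := by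
  rw [tau, sInf_lt_iff]
  constructor
  · rintro ⟨_, ⟨t, ⟨hst, h⟩, rfl⟩, htc⟩
    obtain ⟨a, hsa, hat⟩ := exists_rat_btwn hst
    obtain ⟨b, htb, hbc⟩ := EReal.lt_iff_exists_rat_btwn.1 htc
    exact ⟨a, b, hsa, hbc, t, ⟨hat.le, (EReal.coe_lt_coe_iff.1 htb).le⟩, h⟩
  · rintro ⟨a, b, hsa, hbc, t, ht, h⟩
    exact ⟨t, ⟨t, ⟨hsa.trans_le ht.1, h⟩, rfl⟩, (EReal.coe_le_coe_iff.2 ht.2).trans_lt hbc⟩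

lemma measurable_tau {X : Type*} [MeasurableSpace X] (ξ η : Kernel X ℝ) [IsSFiniteKernel ξ]
    [IsSFiniteKernel η] (hη : ∀ ω, IsLocallyFiniteMeasure (η ω)) :
    Measurable fun p : (X × ℝ) × ℝ => tau (ξ p.1.1) (η p.1.1) p.2 p.1.2 := by
  have hatom : Measurable fun p : X × ℝ => ξ p.1 {p.2} :=
    Kernel.measurable_kernel_prodMk_left (κ := Kernel.prodMkRight ℝ ξ)
      (t := {z : (X × ℝ) × ℝ | z.2 = z.1.2})
      (measurableSet_eq_fun measurable_snd (measurable_snd.comp measurable_fst))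
  have hIoo : ∀ q : ℝ, Measurable fun p : X × ℝ => ξ p.1 (Ioo p.2 q) := fun q =>
    Kernel.measurable_kernel_prodMk_left (κ := Kernel.prodMkRight ℝ ξ)
      (t := {z : (X × ℝ) × ℝ | z.1.2 < z.2 ∧ z.2 < q})
      ((measurableSet_lt (measurable_snd.comp measurable_fst) measurable_snd).inter
        (measurableSet_lt measurable_snd measurable_const))
  have hIcc : ∀ q : ℝ, Measurable fun p : X × ℝ => η p.1 (Icc p.2 q) := fun q =>
    Kernel.measurable_kernel_prodMk_left (κ := Kernel.prodMkRight ℝ η)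
      (t := {z : (X × ℝ) × ℝ | z.1.2 ≤ z.2 ∧ z.2 ≤ q})
      ((measurableSet_le (measurable_snd.comp measurable_fst) measurable_snd).inter
        (measurableSet_le measurable_snd measurable_const))
  refine measurable_of_Iio fun c => ?_
  have hset : (fun p : (X × ℝ) × ℝ => tau (ξ p.1.1) (η p.1.1) p.2 p.1.2) ⁻¹' Iio c =
      ⋃ (a : ℚ) (b : ℚ) (_ : ((b : ℝ) : EReal) < c), {p : (X × ℝ) × ℝ | p.1.2 < a} ∩
        ⋂ n : ℕ, ⋃ (p : ℚ) (q : ℚ) (_ : a ≤ p ∧ p ≤ q ∧ q ≤ b ∧ (q : ℝ) - p ≤ 1 / ((n : ℝ) + 1)),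
          {z : (X × ℝ) × ℝ | ENNReal.ofReal z.2 * ξ z.1.1 {z.1.2} + ξ z.1.1 (Ioo z.1.2 p) ≤
            η z.1.1 (Icc z.1.2 q)} := by
    ext z
    have := hη z.1.1
    simp only [mem_preimage, mem_Iio, tau_lt_iff, mem_iUnion, mem_inter_iff, mem_ofPred_eq,
      mem_iInter, exists_prop]
    refine exists_congr fun a => exists_congr fun b => ?_
    rw [and_left_comm]
    refine and_congr_right fun _ => and_congr_right fun hsa => ?_
    rw [exists_mem_Icc_matching_iff hsa]
  rw [hset]
  refine MeasurableSet.iUnion fun a => MeasurableSet.iUnion fun b => MeasurableSet.iUnion fun _ =>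
    (measurableSet_lt (measurable_snd.comp measurable_fst) measurable_const).inter
      (MeasurableSet.iInter fun n => MeasurableSet.iUnion fun p => MeasurableSet.iUnion fun q =>
        MeasurableSet.iUnion fun _ => measurableSet_le ?_ ?_)
  · exact ((ENNReal.measurable_ofReal.comp measurable_snd).mul (hatom.comp measurable_fst)).add
      ((hIoo p).comp measurable_fst)
  · exact (hIcc q).comp measurable_fst

/-- The matching time as a function of the starting point and of the fraction of its atom. -/
lemma measurable_tau_of_measure (μ ν : Measure ℝ) [SFinite μ] [IsLocallyFiniteMeasure ν] :
    Measurable fun p : ℝ × ℝ => tau μ ν p.2 p.1 :=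
  (measurable_tau (Kernel.const Unit μ) (Kernel.const Unit ν) fun _ => ‹_›).comp
    ((measurable_const.prodMk measurable_fst).prodMk measurable_snd :
      Measurable fun p : ℝ × ℝ => ((((), p.1) : Unit × ℝ), p.2))

lemma matchingMass_eq {μ ν : Measure ℝ} [SFinite μ] [IsLocallyFiniteMeasure ν]
    (s : ℝ) {C : Set ℝ} (hC : MeasurableSet C) :
    matchingMass μ ν s C = volume {u ∈ Icc (0 : ℝ) 1 | tau μ ν u s ∈ Real.toEReal '' C} := by
  have hm : Measurable fun u => tau μ ν u s :=
    (measurable_tau_of_measure μ ν).comp (measurable_const.prodMk measurable_id)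
  have hCm : MeasurableSet ((fun u => tau μ ν u s) ⁻¹' (Real.toEReal '' C)) :=
    hm (EReal.measurableEmbedding_coe.measurableSet_image.2 hC)
  rw [matchingMass]
  change ∫⁻ u in Icc (0 : ℝ) 1,
    ((fun u => tau μ ν u s) ⁻¹' (Real.toEReal '' C)).indicator 1 u = _
  rw [lintegral_indicator_one hCm, Measure.restrict_apply hCm, inter_comm]
  rfl

/-! ### Matching two locally finite measures -/

/-- The fraction of the mass at `s` that is not matched at or to the left of `b`. -/
noncomputable def unmatched (μ ν : Measure ℝ) (b s : ℝ) : ℝ≥0∞ :=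
  volume {u ∈ Icc (0 : ℝ) 1 | (b : EReal) < tau μ ν u s}

/-- The supremum over `t ∈ [a,b]` of `μ[t,b] - ν(t,b]`. -/
noncomputable def maxHeight (μ ν : Measure ℝ) (a b : ℝ) : ℝ :=
  sSup (range (height (μ.restrict (Icc a b)) (ν.restrict (Ioc a b))))

lemma le_tau (μ ν : Measure ℝ) (u s : ℝ) : (s : EReal) ≤ tau μ ν u s :=
  le_sInf (by rintro _ ⟨t, ht, rfl⟩; exact EReal.coe_le_coe_iff.2 ht.1.le)

section Matching

variable {μ ν : Measure ℝ} [IsLocallyFiniteMeasure μ] [IsLocallyFiniteMeasure ν]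

lemma height_restrict {a b t : ℝ} (ht : t ∈ Icc a b) :
    height (μ.restrict (Icc a b)) (ν.restrict (Ioc a b)) t =
      μ.real (Icc t b) - ν.real (Ioc t b) := by
  have h1 : Ici t ∩ Icc a b = Icc t b := by
    ext x
    exact ⟨fun h => ⟨h.1, h.2.2⟩, fun h => ⟨h.1, ht.1.trans h.1, h.2⟩⟩
  have h2 : Ioi t ∩ Ioc a b = Ioc t b := by
    ext x
    exact ⟨fun h => ⟨h.1, h.2.2⟩, fun h => ⟨h.1, ht.1.trans_lt h.1, h.2⟩⟩
  rw [height, measureReal_restrict_apply measurableSet_Ici, h1,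
    measureReal_restrict_apply measurableSet_Ioi, h2]

lemma height_restrict_of_lt {a b t : ℝ} (ht : b < t) :
    height (μ.restrict (Icc a b)) (ν.restrict (Ioc a b)) t = 0 := by
  have h1 : Ici t ∩ Icc a b = ∅ := by
    ext x
    simp only [mem_inter_iff, mem_Ici, mem_Icc, mem_empty_iff_false, iff_false]
    exact fun h => absurd (ht.trans_le h.1) (not_lt.2 h.2.2)
  have h2 : Ioi t ∩ Ioc a b = ∅ := by
    ext x
    simp only [mem_inter_iff, mem_Ioi, mem_Ioc, mem_empty_iff_false, iff_false]
    exact fun h => absurd (ht.trans h.1) (not_lt.2 h.2.2)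
  rw [height, measureReal_restrict_apply measurableSet_Ici, h1,
    measureReal_restrict_apply measurableSet_Ioi, h2]
  simp

instance isFiniteMeasure_restrict_Icc' (a b : ℝ) : IsFiniteMeasure (μ.restrict (Icc a b)) :=
  ⟨by rw [Measure.restrict_apply_univ]; exact measure_Icc_lt_top⟩

instance isFiniteMeasure_restrict_Ioc' (a b : ℝ) : IsFiniteMeasure (ν.restrict (Ioc a b)) :=
  ⟨by rw [Measure.restrict_apply_univ]; exact measure_Ioc_lt_top⟩

lemma le_maxHeight {a b t : ℝ} (ht : t ∈ Icc a b) :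
    μ.real (Icc t b) - ν.real (Ioc t b) ≤ maxHeight μ ν a b := by
  rw [← height_restrict ht]
  exact le_csSup bddAbove_range_height ⟨t, rfl⟩

lemma maxHeight_nonneg {a b : ℝ} (hab : a ≤ b) : 0 ≤ maxHeight μ ν a b := by
  have := le_maxHeight (μ := μ) (ν := ν) (right_mem_Icc.2 hab)
  rw [Ioc_self, measureReal_empty, sub_zero] at this
  exact measureReal_nonneg.trans this

lemma maxHeight_le {a b c : ℝ} (hab : a ≤ b)
    (h : ∀ t ∈ Icc a b, μ.real (Icc t b) - ν.real (Ioc t b) ≤ c) : maxHeight μ ν a b ≤ c := by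
  refine csSup_le (range_nonempty _) ?_
  rintro _ ⟨t, rfl⟩
  rcases lt_or_ge b t with hbt | htb
  · rw [height_restrict_of_lt hbt]
    refine le_trans ?_ (h b (right_mem_Icc.2 hab))
    rw [Ioc_self, measureReal_empty, sub_zero]
    exact measureReal_nonneg
  rcases le_or_gt a t with hat | hta
  · rw [height_restrict ⟨hat, htb⟩]
    exact h t ⟨hat, htb⟩
  · refine le_trans ?_ (h a (left_mem_Icc.2 hab))
    have h2 : Ioi t ∩ Ioc a b = Ioc a b := inter_eq_right.2 fun x hx => hta.trans hx.1
    rw [height, measureReal_restrict_apply measurableSet_Ioi, h2,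
      measureReal_restrict_apply measurableSet_Ici]
    exact sub_le_sub_right (measureReal_mono inter_subset_right measure_Icc_lt_top.ne) _

lemma measureReal_Ioo_add {s t : ℝ} (h : s < t) :
    μ.real (Ico s t) = μ.real {s} + μ.real (Ioo s t) := by
  rw [← Ioo_insert_left h, insert_eq, measureReal_union ?_ measurableSet_Ioo
    isCompact_singleton.measure_lt_top.ne measure_Ioo_lt_top.ne]
  simp

/-- The matching condition at `t`, in terms of heights. -/
lemma matching_le_iff {s t u : ℝ} (hst : s < t) (hu : 0 ≤ u) (hνs : ν {s} = 0) :
    ENNReal.ofReal u * μ {s} + μ (Ioo s t) ≤ ν (Icc s t) ↔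
      μ.real (Ico s t) - ν.real (Ioc s t) ≤ (1 - u) * μ.real {s} := by
  have h1 : ν (Icc s t) = ν (Ioc s t) := by
    refine le_antisymm ?_ (measure_mono Ioc_subset_Icc_self)
    rw [← Ioc_insert_left hst.le, insert_eq]
    exact (measure_union_le _ _).trans_eq (by rw [hνs, zero_add])
  have hs : μ {s} ≠ ∞ := isCompact_singleton.measure_lt_top.ne
  have hl : ENNReal.ofReal u * μ {s} + μ (Ioo s t) ≠ ∞ :=
    ENNReal.add_ne_top.2 ⟨ENNReal.mul_ne_top ENNReal.ofReal_ne_top hs, measure_Ioo_lt_top.ne⟩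
  rw [h1, ← ENNReal.toReal_le_toReal hl measure_Ioc_lt_top.ne,
    ENNReal.toReal_add (ENNReal.mul_ne_top ENNReal.ofReal_ne_top hs) measure_Ioo_lt_top.ne,
    ENNReal.toReal_mul, ENNReal.toReal_ofReal hu, measureReal_Ioo_add hst]
  simp only [Measure.real]
  constructor <;> intro h <;> linarith

/-- If the matching time is at most `b`, then the matching condition holds somewhere in `(s,b]` or,
by right continuity of `ν (Icc s t)` in `t`, at `b`; the second case matters only for `s = b`. -/
lemma tau_le_cases {s b u : ℝ} (hsb : s ≤ b) (h : tau μ ν u s ≤ b) :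
    (∃ t, s < t ∧ t ≤ b ∧ ENNReal.ofReal u * μ {s} + μ (Ioo s t) ≤ ν (Icc s t)) ∨
      ENNReal.ofReal u * μ {s} + μ (Ioo s b) ≤ ν (Icc s b) := by
  by_contra! hcon
  obtain ⟨hcon1, hcon2⟩ := hcon
  refine absurd (le_measure_Icc_of_forall_gt hsb fun t' ht' => ?_) (not_le.2 hcon2)
  obtain ⟨_, ⟨t, ⟨hst, ht⟩, rfl⟩, htt'⟩ :=
    sInf_lt_iff.1 (h.trans_lt (EReal.coe_lt_coe_iff.2 ht'))
  have hbt : b < t := by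
    by_contra! htb
    exact absurd ht (not_le.2 (hcon1 t hst htb))
  exact (add_le_add_right (measure_mono (Ioo_subset_Ioo_right hbt.le)) _).trans
    (ht.trans (measure_mono (Icc_subset_Icc_right (EReal.coe_lt_coe_iff.1 htt').le)))

/-- Mass is unmatched at time `b` if and only if it starts a strict record of the height. The
case `u = 0` is excluded, and so is the case `s = b` unless `b` is an atom of `μ`. -/
lemma lt_tau_iff {a b s u : ℝ} (hs : s ∈ Icc a b) (hνs : ν {s} = 0) (hu : u ∈ Ioc (0 : ℝ) 1)
    (hsb : s = b → μ {s} ≠ 0) :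
    (b : EReal) < tau μ ν u s ↔ ∀ t, s < t →
      height (μ.restrict (Icc a b)) (ν.restrict (Ioc a b)) t <
        height (μ.restrict (Icc a b)) (ν.restrict (Ioc a b)) s -
          (1 - u) * (μ.restrict (Icc a b)).real {s} := by
  have hatom : (μ.restrict (Icc a b)).real {s} = μ.real {s} := by
    rw [measureReal_restrict_apply (measurableSet_singleton s),
      inter_eq_left.2 (singleton_subset_iff.2 hs)]
  have hdiff : ∀ t, s < t → t ≤ b →
      height (μ.restrict (Icc a b)) (ν.restrict (Ioc a b)) s -
        height (μ.restrict (Icc a b)) (ν.restrict (Ioc a b)) t =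
      μ.real (Ico s t) - ν.real (Ioc s t) := by
    intro t hst htb
    rw [height_sub hst.le, measureReal_restrict_apply measurableSet_Ico,
      measureReal_restrict_apply measurableSet_Ioc]
    rw [inter_eq_left.2 (show Ico s t ⊆ Icc a b from fun x hx =>
      ⟨hs.1.trans hx.1, hx.2.le.trans htb⟩), inter_eq_left.2 (show Ioc s t ⊆ Ioc a b from
      fun x hx => ⟨hs.1.trans_lt hx.1, hx.2.trans htb⟩)]
  rw [hatom]
  constructor
  · intro h
    have hnot : ∀ t, s < t → t ≤ b →
        height (μ.restrict (Icc a b)) (ν.restrict (Ioc a b)) t <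
        height (μ.restrict (Icc a b)) (ν.restrict (Ioc a b)) s - (1 - u) * μ.real {s} := by
      intro t hst htb
      by_contra! hcon
      have := (matching_le_iff (μ := μ) (ν := ν) hst hu.1.le hνs).2
        (by linarith [hdiff t hst htb])
      have htau : tau μ ν u s ≤ (t : EReal) := sInf_le ⟨t, ⟨hst, this⟩, rfl⟩
      exact absurd h (not_lt.2 (htau.trans (EReal.coe_le_coe_iff.2 htb)))
    intro t hst
    rcases le_or_gt t b with htb | hbt
    · exact hnot t hst htb
    rw [height_restrict_of_lt hbt]
    rcases hs.2.eq_or_lt with rfl | hlt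
    · have : 0 < μ.real {s} :=
        ENNReal.toReal_pos (hsb rfl) isCompact_singleton.measure_lt_top.ne
      rw [height_restrict hs, Icc_self, Ioc_self, measureReal_empty]
      nlinarith [mul_pos hu.1 this]
    · refine lt_of_le_of_lt ?_ (hnot b hlt le_rfl)
      rw [height_restrict ⟨hs.1.trans hlt.le, le_rfl⟩, Ioc_self, measureReal_empty, sub_zero]
      exact measureReal_nonneg
  · intro h
    by_contra! hcon
    have hno : ∀ t, s < t → t ≤ b →
        ¬ ENNReal.ofReal u * μ {s} + μ (Ioo s t) ≤ ν (Icc s t) := by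
      intro t hst htb hle
      have h1 := (matching_le_iff hst hu.1.le hνs).1 hle
      linarith [h t hst, hdiff t hst htb]
    rcases tau_le_cases hs.2 hcon with ⟨t, hst, htb, hle⟩ | hle
    · exact hno t hst htb hle
    · rcases hs.2.eq_or_lt with rfl | hlt
      · rw [Icc_self, hνs] at hle
        have h0 := nonpos_iff_eq_zero.1 ((le_add_right le_rfl).trans hle)
        rcases mul_eq_zero.1 h0 with h1 | h1
        · exact absurd (ENNReal.ofReal_eq_zero.1 h1) (not_le.2 hu.1)
        · exact hsb rfl h1
      · exact hno b hlt le_rfl hle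

/-- The mass of `μ` on `[a,b]` that is not matched within `[a,b]`. -/
theorem setLIntegral_unmatched (h : μ ⟂ₘ ν) (a b : ℝ) :
    ∫⁻ s in Icc a b, unmatched μ ν b s ∂μ = ENNReal.ofReal (maxHeight μ ν a b) := by
  obtain ⟨T, hT, hμT, hνT⟩ := h
  have hμ' : μ.restrict (Icc a b) Tᶜᶜ = 0 := by
    rw [compl_compl]
    exact Measure.absolutelyContinuous_of_le Measure.restrict_le_self hμT
  rw [maxHeight, ← lintegral_volume_height_lt hT.compl hμ'
    (Measure.absolutelyContinuous_of_le Measure.restrict_le_self hνT)]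
  -- the right endpoint matters only if it is an atom: otherwise its matching time may be `b` itself
  have hb : ∀ᵐ s ∂μ, s = b → μ {s} ≠ 0 := by
    by_cases hb0 : μ {b} = 0
    · filter_upwards [compl_mem_ae_iff.2 hb0] with s hs hsb
      exact absurd hsb hs
    · exact Eventually.of_forall fun s hsb => by rwa [hsb]
  refine setLIntegral_congr_fun_ae measurableSet_Icc ?_
  filter_upwards [compl_mem_ae_iff.2 hμT, hb] with s hsT hsb hs
  have hνs : ν {s} = 0 := measure_mono_null (singleton_subset_iff.2 hsT) hνT
  refine measure_congr ?_
  filter_upwards [compl_mem_ae_iff.2 (measure_singleton (0 : ℝ) : volume {(0 : ℝ)} = 0)]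
    with u hu0
  refine propext (and_congr_right fun hu => ?_)
  exact lt_tau_iff hs hνs ⟨lt_of_le_of_ne hu.1 (Ne.symm hu0), hu.2⟩ hsb

lemma measurable_unmatched (b : ℝ) : Measurable (unmatched μ ν b) := by
  have hset : MeasurableSet {p : ℝ × ℝ | p.2 ∈ Icc (0 : ℝ) 1 ∧ (b : EReal) < tau μ ν p.2 p.1} :=
    (measurable_snd measurableSet_Icc).inter
      (measurable_tau_of_measure μ ν (measurableSet_Ioi (a := (b : EReal))))
  exact measurable_measure_prodMk_left hset

lemma measurableSet_lt_tau (b s : ℝ) :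
    MeasurableSet {u ∈ Icc (0 : ℝ) 1 | (b : EReal) < tau μ ν u s} :=
  measurableSet_Icc.inter (((measurable_tau_of_measure μ ν).comp
    (measurable_const.prodMk measurable_id)) (measurableSet_Ioi (a := (b : EReal))))

lemma matchingMass_le_one (s : ℝ) {C : Set ℝ} (hC : MeasurableSet C) :
    matchingMass μ ν s C ≤ 1 := by
  rw [matchingMass_eq s hC]
  exact (measure_mono (sep_subset _ _)).trans_eq (by rw [Real.volume_Icc]; simp)

lemma unmatched_of_lt {b s : ℝ} (h : b < s) : unmatched μ ν b s = 1 := by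
  have : {u ∈ Icc (0 : ℝ) 1 | (b : EReal) < tau μ ν u s} = Icc 0 1 :=
    sep_eq_self_iff_mem_true.2 fun u _ => (EReal.coe_lt_coe_iff.2 h).trans_le (le_tau μ ν u s)
  rw [unmatched, this, Real.volume_Icc]
  simp

lemma matchingMass_Ioc_of_lt {a b s : ℝ} (h : b < s) : matchingMass μ ν s (Ioc a b) = 0 := by
  rw [matchingMass_eq s measurableSet_Ioc]
  refine measure_mono_null (t := ∅) ?_ measure_empty
  rintro u ⟨_, t, ht, htau⟩
  have := le_tau μ ν u s
  rw [← htau, EReal.coe_le_coe_iff] at this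
  exact absurd (h.trans_le this) (not_lt.2 ht.2)

lemma matchingMass_Ioc_add_unmatched {a b : ℝ} (hab : a ≤ b) (s : ℝ) :
    matchingMass μ ν s (Ioc a b) + unmatched μ ν b s = unmatched μ ν a s := by
  rw [matchingMass_eq s measurableSet_Ioc, unmatched, unmatched,
    ← measure_union ?_ (measurableSet_lt_tau b s)]
  · congr 1
    ext u
    constructor
    · rintro (⟨hu, t, ht, htau⟩ | ⟨hu, h⟩)
      · exact ⟨hu, by rw [← htau]; exact EReal.coe_lt_coe_iff.2 ht.1⟩
      · exact ⟨hu, (EReal.coe_le_coe_iff.2 hab).trans_lt h⟩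
    · rintro ⟨hu, h⟩
      rcases lt_or_ge (b : EReal) (tau μ ν u s) with hb | hb
      · exact Or.inr ⟨hu, hb⟩
      · refine Or.inl ⟨hu, (tau μ ν u s).toReal, ?_⟩
        have hcoe : (((tau μ ν u s).toReal : ℝ) : EReal) = tau μ ν u s :=
          EReal.coe_toReal (hb.trans_lt (EReal.coe_lt_top b)).ne
            ((EReal.bot_lt_coe a).trans h).ne'
        rw [← hcoe] at h hb
        exact ⟨⟨EReal.coe_lt_coe_iff.1 h, EReal.coe_le_coe_iff.1 hb⟩, hcoe⟩
  · refine Set.disjoint_left.2 ?_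
    rintro u ⟨_, t, ht, htau⟩ ⟨_, h⟩
    rw [← htau] at h
    exact absurd (EReal.coe_lt_coe_iff.1 h) (not_lt.2 ht.2)

lemma one_sub_matchingMass_le (b s : ℝ) :
    1 - matchingMass μ ν s univ ≤ unmatched μ ν b s := by
  rw [tsub_le_iff_left, matchingMass_eq s MeasurableSet.univ]
  have hsub : Icc (0 : ℝ) 1 ⊆ {u ∈ Icc (0 : ℝ) 1 | tau μ ν u s ∈ Real.toEReal '' univ} ∪
      {u ∈ Icc (0 : ℝ) 1 | (b : EReal) < tau μ ν u s} := by
    intro u hu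
    by_cases h : tau μ ν u s = ⊤
    · exact Or.inr ⟨hu, by rw [h]; exact EReal.coe_lt_top b⟩
    · exact Or.inl ⟨hu, _, mem_univ _, EReal.coe_toReal h
        ((EReal.bot_lt_coe s).trans_le (le_tau μ ν u s)).ne'⟩
  refine le_trans (le_of_eq ?_) ((measure_mono hsub).trans (measure_union_le _ _))
  rw [Real.volume_Icc]
  simp

/-- The mass of `[c,a]` unmatched at time `a`, together with the mass on `(a,b]`, is either
transported to `(a,b]` or unmatched at time `b`. -/
lemma setLIntegral_matchingMass_add (h : μ ⟂ₘ ν) {c a b : ℝ} (hca : c ≤ a) (hab : a ≤ b) :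
    ∫⁻ s in Ici c, matchingMass μ ν s (Ioc a b) ∂μ + ENNReal.ofReal (maxHeight μ ν c b) =
      ENNReal.ofReal (maxHeight μ ν c a) + μ (Ioc a b) := by
  have h1 : ∫⁻ s in Ici c, matchingMass μ ν s (Ioc a b) ∂μ =
      ∫⁻ s in Icc c b, matchingMass μ ν s (Ioc a b) ∂μ := by
    rw [← Icc_union_Ioi_eq_Ici (hca.trans hab), lintegral_union measurableSet_Ioi
      (Set.disjoint_left.2 fun x hx hx' => not_lt.2 hx.2 hx'),
      setLIntegral_congr_fun measurableSet_Ioi fun s hs => matchingMass_Ioc_of_lt hs,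
      lintegral_zero, add_zero]
  rw [h1, ← setLIntegral_unmatched h, ← setLIntegral_unmatched h,
    ← lintegral_add_right _ (measurable_unmatched b)]
  simp only [matchingMass_Ioc_add_unmatched hab]
  rw [← Icc_union_Ioc_eq_Icc hca hab, lintegral_union measurableSet_Ioc
    (Set.disjoint_left.2 fun x hx hx' => not_lt.2 hx.2 hx'.1),
    setLIntegral_congr_fun measurableSet_Ioc fun s hs => unmatched_of_lt hs.1, setLIntegral_one]

lemma measureReal_Icc_sub_Ioc {t a b : ℝ} (hta : t ≤ a) (hab : a ≤ b) :
    μ.real (Icc t b) - ν.real (Ioc t b) =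
      μ.real (Icc t a) - ν.real (Ioc t a) + μ.real (Ioc a b) - ν.real (Ioc a b) := by
  rw [← Icc_union_Ioc_eq_Icc hta hab, measureReal_union
    (Set.disjoint_left.2 fun x hx hx' => not_lt.2 hx.2 hx'.1) measurableSet_Ioc
    measure_Icc_lt_top.ne measure_Ioc_lt_top.ne, ← Ioc_union_Ioc_eq_Ioc hta hab,
    measureReal_union
    (Set.disjoint_left.2 fun x hx hx' => not_lt.2 hx.2 hx'.1) measurableSet_Ioc
    measure_Ioc_lt_top.ne measure_Ioc_lt_top.ne]
  ring

lemma maxHeight_add_le {c a b : ℝ} (hca : c ≤ a) (hab : a ≤ b) :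
    maxHeight μ ν c a + μ.real (Ioc a b) ≤ maxHeight μ ν c b + ν.real (Ioc a b) := by
  have : maxHeight μ ν c a ≤ maxHeight μ ν c b + ν.real (Ioc a b) - μ.real (Ioc a b) := by
    refine maxHeight_le hca fun t ht => ?_
    have h1 := measureReal_Icc_sub_Ioc (μ := μ) (ν := ν) ht.2 hab
    have h2 := le_maxHeight (μ := μ) (ν := ν) (a := c) (b := b) ⟨ht.1, ht.2.trans hab⟩
    linarith
  linarith

/-- The matching does not send more mass to an interval than `ν` has there. -/
theorem lintegral_matchingMass_Ioc_le (h : μ ⟂ₘ ν) {a b : ℝ} (hab : a ≤ b) :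
    ∫⁻ s, matchingMass μ ν s (Ioc a b) ∂μ ≤ ν (Ioc a b) := by
  have hbound : ∀ c ≤ a, ∫⁻ s in Ici c, matchingMass μ ν s (Ioc a b) ∂μ ≤ ν (Ioc a b) := by
    intro c hca
    refine (ENNReal.add_le_add_iff_right (ENNReal.ofReal_ne_top
      (r := maxHeight μ ν c b))).1 ?_
    rw [setLIntegral_matchingMass_add h hca hab, ← ofReal_measureReal measure_Ioc_lt_top.ne,
      ← ofReal_measureReal (measure_Ioc_lt_top (μ := ν)).ne,
      ← ENNReal.ofReal_add (maxHeight_nonneg hca) measureReal_nonneg,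
      ← ENNReal.ofReal_add measureReal_nonneg (maxHeight_nonneg (hca.trans hab))]
    refine ENNReal.ofReal_le_ofReal ?_
    linarith [maxHeight_add_le (μ := μ) (ν := ν) hca hab]
  have hU : (⋃ n : ℕ, Ici (a - n)) = univ := by
    refine eq_univ_of_forall fun x => mem_iUnion.2 ?_
    obtain ⟨n, hn⟩ := exists_nat_gt (a - x)
    exact ⟨n, by rw [mem_Ici]; linarith⟩
  rw [← setLIntegral_univ, ← hU, setLIntegral_iUnion_of_directed]
  · exact iSup_le fun n => hbound _ (sub_le_self _ n.cast_nonneg)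
  · refine Monotone.directed_le fun i j hij => Ici_subset_Ici.2 ?_
    have : (i : ℝ) ≤ j := by exact_mod_cast hij
    linarith

/-- If some mass to the left of `m` stays unmatched, then all of `ν` to the right of `m` is used:
for every `b ≥ m` the supremum `maxHeight μ ν c b` is only approached to the left of `m`, so that
replacing `a` by `b` changes it by exactly `μ (Ioc a b) - ν (Ioc a b)`. -/
theorem lintegral_matchingMass_Ioc_eq (h : μ ⟂ₘ ν) {m a b : ℝ} (hma : m ≤ a) (hab : a ≤ b)
    (hm : ∫⁻ s in Iio m, (1 - matchingMass μ ν s univ) ∂μ ≠ 0) :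
    ∫⁻ s, matchingMass μ ν s (Ioc a b) ∂μ = ν (Ioc a b) := by
  refine le_antisymm (lintegral_matchingMass_Ioc_le h hab) ?_
  have hU : (⋃ n : ℕ, Ico (m - n) m) = Iio m := by
    ext x
    simp only [mem_iUnion, mem_Ico, mem_Iio]
    refine ⟨fun ⟨n, hn⟩ => hn.2, fun hx => ?_⟩
    obtain ⟨n, hn⟩ := exists_nat_gt (m - x)
    exact ⟨n, by linarith, hx⟩
  rw [← hU, setLIntegral_iUnion_of_directed] at hm
  swap
  · refine Monotone.directed_le fun i j hij => Ico_subset_Ico_left ?_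
    have : (i : ℝ) ≤ j := by exact_mod_cast hij
    linarith
  obtain ⟨n, hn⟩ := not_forall.1 (mt ENNReal.iSup_eq_zero.2 hm)
  set c := m - n
  have hcm : c ≤ m := sub_le_self _ n.cast_nonneg
  have hmb : m ≤ b := hma.trans hab
  have hca : c ≤ a := hcm.trans hma
  have hpos : 0 < ∫⁻ s in Ico c m, unmatched μ ν b s ∂μ :=
    (pos_iff_ne_zero.2 hn).trans_le (lintegral_mono fun s => one_sub_matchingMass_le b s)
  have hlt : maxHeight μ ν m b < maxHeight μ ν c b := by
    have hsplit : ∫⁻ s in Icc c b, unmatched μ ν b s ∂μ =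
        ∫⁻ s in Ico c m, unmatched μ ν b s ∂μ + ∫⁻ s in Icc m b, unmatched μ ν b s ∂μ := by
      rw [← Ico_union_Icc_eq_Icc hcm hmb, lintegral_union measurableSet_Icc
        (Set.disjoint_left.2 fun x hx hx' => not_le.2 hx.2 hx'.1)]
    rw [setLIntegral_unmatched h, setLIntegral_unmatched h] at hsplit
    by_contra! hcon
    have h1 := ENNReal.ofReal_le_ofReal hcon
    rw [hsplit] at h1
    rw [add_comm] at h1
    exact absurd h1 (not_le.2 (ENNReal.lt_add_right ENNReal.ofReal_ne_top hpos.ne'))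
  have hle : maxHeight μ ν c b ≤ maxHeight μ ν c a + μ.real (Ioc a b) - ν.real (Ioc a b) := by
    have hmax : maxHeight μ ν c b ≤ max (maxHeight μ ν m b)
        (maxHeight μ ν c a + μ.real (Ioc a b) - ν.real (Ioc a b)) := by
      refine maxHeight_le (hca.trans hab) fun t ht => ?_
      rcases le_total m t with hmt | htm
      · exact le_max_of_le_left (le_maxHeight ⟨hmt, ht.2⟩)
      · refine le_max_of_le_right ?_
        have hta := htm.trans hma
        have h1 := measureReal_Icc_sub_Ioc (μ := μ) (ν := ν) hta hab
        have h2 := le_maxHeight (μ := μ) (ν := ν) (a := c) (b := a) ⟨ht.1, hta⟩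
        linarith
    exact (le_max_iff.1 hmax).resolve_left (not_le.2 hlt)
  have hfinal : ν (Ioc a b) ≤ ∫⁻ s in Ici c, matchingMass μ ν s (Ioc a b) ∂μ := by
    refine (ENNReal.add_le_add_iff_right (ENNReal.ofReal_ne_top
      (r := maxHeight μ ν c b))).1 ?_
    rw [setLIntegral_matchingMass_add h hca hab,
      ← ofReal_measureReal (measure_Ioc_lt_top (μ := μ)).ne,
      ← ofReal_measureReal (measure_Ioc_lt_top (μ := ν)).ne,
      ← ENNReal.ofReal_add (maxHeight_nonneg hca) measureReal_nonneg,
      ← ENNReal.ofReal_add measureReal_nonneg (maxHeight_nonneg (hca.trans hab))]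
    refine ENNReal.ofReal_le_ofReal ?_
    linarith
  exact hfinal.trans (setLIntegral_le_lintegral _ _)

end Matching

/-! ### Locally finite kernels and the matching kernel -/

section Kernel

variable {X : Type*} [MeasurableSpace X]

lemma isSFiniteKernel_of_forall_lt_top (κ : Kernel X ℝ) (h : ∀ ω, κ ω univ < ∞) :
    IsSFiniteKernel κ := by
  have hm : Measurable fun ω => ⌊(κ ω univ).toReal⌋₊ :=
    Nat.measurable_floor.comp (κ.measurable_coe MeasurableSet.univ).ennreal_toReal
  have hms : ∀ n : ℕ, MeasurableSet {ω | ⌊(κ ω univ).toReal⌋₊ = n} := fun n =>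
    hm (measurableSet_singleton n)
  have : ∀ n, DecidablePred (· ∈ {ω | ⌊(κ ω univ).toReal⌋₊ = n}) := fun n => Classical.decPred _
  have hκ : κ = Kernel.sum fun n : ℕ => Kernel.piecewise (hms n) κ 0 := by
    ext ω s hs
    rw [Kernel.sum_apply' _ _ hs, tsum_eq_single ⌊(κ ω univ).toReal⌋₊]
    · simp [Kernel.piecewise_apply]
    · intro n hn
      have hω : ω ∉ {ω | ⌊(κ ω univ).toReal⌋₊ = n} := fun hmem => hn (Eq.symm hmem)
      rw [Kernel.piecewise_apply, if_neg hω]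
      simp
  rw [hκ]
  have hfin : ∀ n, IsFiniteKernel (Kernel.piecewise (hms n) κ 0) := fun n => by
    refine ⟨(n : ℝ≥0∞) + 1, by simp, fun ω => ?_⟩
    rw [Kernel.piecewise_apply]
    split_ifs with hmem
    · have h1 := Nat.lt_floor_add_one (κ ω univ).toReal
      rw [show ⌊(κ ω univ).toReal⌋₊ = n from hmem] at h1
      rw [← ENNReal.ofReal_toReal (h ω).ne]
      refine (ENNReal.ofReal_le_ofReal h1.le).trans_eq ?_
      rw [ENNReal.ofReal_add n.cast_nonneg zero_le_one]
      simp
    · simp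
  infer_instance

lemma isSFiniteKernel_of_isLocallyFiniteMeasure (κ : Kernel X ℝ)
    (h : ∀ ω, IsLocallyFiniteMeasure (κ ω)) : IsSFiniteKernel κ := by
  have hκ : κ = Kernel.sum fun n : ℤ =>
      κ.restrict (measurableSet_Ioc (a := (n : ℝ)) (b := (n : ℝ) + 1)) := by
    ext1 ω
    rw [Kernel.sum_apply]
    simp only [Kernel.restrict_apply]
    rw [← Measure.restrict_iUnion (pairwise_disjoint_Ioc_intCast ℝ) fun _ => measurableSet_Ioc,
      iUnion_Ioc_intCast, Measure.restrict_univ]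
  rw [hκ]
  refine Kernel.isSFiniteKernel_sum (hκs := fun n => isSFiniteKernel_of_forall_lt_top _ fun ω => ?_)
  have := h ω
  rw [Kernel.restrict_apply, Measure.restrict_apply_univ]
  exact measure_Ioc_lt_top

lemma FiniteOnCompacts.isLocallyFiniteMeasure {μ : Measure ℝ} (h : FiniteOnCompacts μ) :
    IsLocallyFiniteMeasure μ :=
  have : IsFiniteMeasureOnCompacts μ := ⟨fun {C} hC => h C hC⟩
  isLocallyFiniteMeasure_of_isFiniteMeasureOnCompacts

lemma finiteOnCompacts_iff {μ : Measure ℝ} :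
    FiniteOnCompacts μ ↔ ∀ n : ℕ, μ (Icc (-(n : ℝ)) n) < ∞ := by
  refine ⟨fun h n => h _ isCompact_Icc, fun h C hC => ?_⟩
  obtain ⟨r, hr⟩ := hC.isBounded.subset_closedBall 0
  obtain ⟨n, hn⟩ := exists_nat_ge r
  refine (measure_mono (hr.trans ?_)).trans_lt (h n)
  rw [Real.closedBall_eq_Icc]
  exact Icc_subset_Icc (by linarith) (by linarith)

lemma measurableSet_finiteOnCompacts (κ : Kernel X ℝ) :
    MeasurableSet {ω | FiniteOnCompacts (κ ω)} := by
  simp only [finiteOnCompacts_iff, ofPred_forall]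
  exact MeasurableSet.iInter fun n =>
    κ.measurable_coe measurableSet_Icc measurableSet_Iio

/-- The kernel that moves a uniformly chosen part of the mass at `s` to its matching time. -/
theorem exists_matchingKernel (ξ η : Kernel X ℝ) [IsSFiniteKernel ξ] [IsSFiniteKernel η]
    (hη : ∀ ω, IsLocallyFiniteMeasure (η ω)) :
    ∃ K : Kernel (X × ℝ) ℝ, ∀ (ω : X) (s : ℝ) (C : Set ℝ), MeasurableSet C →
      K (ω, s) C = matchingMass (ξ ω) (η ω) s C := by
  have htau := measurable_tau ξ η hη
  have hsec : ∀ p : X × ℝ, Measurable fun u => tau (ξ p.1) (η p.1) u p.2 := fun p =>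
    htau.comp measurable_prodMk_left
  let k : X × ℝ → Measure ℝ := fun p =>
    (Measure.map (fun u => tau (ξ p.1) (η p.1) u p.2)
      (volume.restrict (Icc (0 : ℝ) 1))).comap Real.toEReal
  have hk : ∀ p C, MeasurableSet C → k p C = volume.restrict (Icc (0 : ℝ) 1)
      ((fun u => tau (ξ p.1) (η p.1) u p.2) ⁻¹' (Real.toEReal '' C)) := fun p C hC => by
    have hC' : MeasurableSet (Real.toEReal '' C) :=
      EReal.measurableEmbedding_coe.measurableSet_image.2 hC
    simp only [k]
    rw [EReal.measurableEmbedding_coe.comap_apply, Measure.map_apply (hsec p) hC']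
  have hmeas : Measurable k := by
    refine Measure.measurable_of_measurable_coe _ fun C hC => ?_
    simp only [hk _ C hC]
    exact measurable_measure_prodMk_left
      (htau (EReal.measurableEmbedding_coe.measurableSet_image.2 hC))
  refine ⟨⟨k, hmeas⟩, fun ω s C hC => ?_⟩
  have := hη ω
  have hC' : MeasurableSet ((fun u => tau (ξ ω) (η ω) u s) ⁻¹' (Real.toEReal '' C)) :=
    hsec (ω, s) (EReal.measurableEmbedding_coe.measurableSet_image.2 hC)
  rw [matchingMass_eq s hC]
  refine (hk (ω, s) C hC).trans ?_
  rw [Measure.restrict_apply hC', inter_comm]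
  rfl

end Kernel

/-! ### Translations -/

lemma map_sub_apply (μ : Measure ℝ) (t : ℝ) (C : Set ℝ) :
    μ.map (fun x => x - t) C = μ ((fun x => x - t) ⁻¹' C) :=
  (MeasurableEquiv.subRight t).map_apply C

lemma tau_map_sub_const (μ ν : Measure ℝ) (t u s : ℝ) :
    tau (μ.map fun x => x - t) (ν.map fun x => x - t) u s = tau μ ν u (s + t) - t := by
  have hiff : ∀ r : ℝ,
      (s < r ∧ ENNReal.ofReal u * (μ.map fun x => x - t) {s} + (μ.map fun x => x - t) (Ioo s r) ≤
        (ν.map fun x => x - t) (Icc s r)) ↔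
      (s + t < r + t ∧ ENNReal.ofReal u * μ {s + t} + μ (Ioo (s + t) (r + t)) ≤
        ν (Icc (s + t) (r + t))) := by
    intro r
    simp only [map_sub_apply, preimage_sub_const_Ioo, preimage_sub_const_Icc, add_lt_add_iff_right]
    rw [show (fun x : ℝ => x - t) ⁻¹' {s} = {s + t} by ext; simp [sub_eq_iff_eq_add]]
  refine le_antisymm ?_ (le_sInf ?_)
  · refine EReal.le_sub_iff_add_le (by simp) (by simp) |>.2 (le_sInf ?_)
    rintro _ ⟨r, hr, rfl⟩
    have h1 : tau (μ.map fun x => x - t) (ν.map fun x => x - t) u s ≤ ((r - t : ℝ) : EReal) :=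
      sInf_le ⟨r - t, (hiff _).2 (by simpa using hr), rfl⟩
    refine (add_le_add_left h1 _).trans_eq ?_
    rw [← EReal.coe_add, sub_add_cancel]
  · rintro _ ⟨r, hr, rfl⟩
    have h1 : tau μ ν u (s + t) ≤ ((r + t : ℝ) : EReal) := sInf_le ⟨r + t, (hiff _).1 hr, rfl⟩
    refine EReal.sub_le_of_le_add ?_
    rwa [← EReal.coe_add]

lemma matchingMass_map_sub_const (μ ν : Measure ℝ) (t s : ℝ) (C : Set ℝ) :
    matchingMass (μ.map fun x => x - t) (ν.map fun x => x - t) s C =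
      matchingMass μ ν (s + t) ((fun x => x - t) ⁻¹' C) := by
  refine lintegral_congr fun u => ?_
  simp only [tau_map_sub_const]
  have : tau μ ν u (s + t) - t ∈ Real.toEReal '' C ↔
      tau μ ν u (s + t) ∈ Real.toEReal '' ((fun x => x - t) ⁻¹' C) := by
    induction tau μ ν u (s + t) with
    | bot => simp
    | top => simp
    | coe x =>
      rw [← EReal.coe_sub, EReal.coe_injective.mem_set_image, EReal.coe_injective.mem_set_image]
      rfl
  by_cases h : tau μ ν u (s + t) - t ∈ Real.toEReal '' C
  · rw [indicator_of_mem h, indicator_of_mem (this.1 h)]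
  · rw [indicator_of_notMem h, indicator_of_notMem (mt this.2 h)]

/-! ### Equivariance and the zero-one law -/

section Flow

variable {Ω : Type*} [MeasurableSpace Ω]

/-- The sample points at which both kernels are invariant and mutually singular. The invariance is
required for all times at once, so that this set is strictly invariant under the flow. -/
structure IsGood (θ : MeasurableFlow Ω) (ξ η : Kernel Ω ℝ) (ω : Ω) : Prop where
  left : ∀ t, ξ (θ t ω) = (ξ ω).map fun x => x - t
  right : ∀ t, η (θ t ω) = (η ω).map fun x => x - t
  singular : ξ ω ⟂ₘ η ω

variable {θ : MeasurableFlow Ω} {P : Measure Ω} {ξ η : Kernel Ω ℝ} {K : Kernel (Ω × ℝ) ℝ}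

lemma MeasurableFlow.apply_add (θ : MeasurableFlow Ω) (s t : ℝ) (ω : Ω) :
    θ s (θ t ω) = θ (s + t) ω := congrFun (θ.comp' s t) ω

lemma MeasurableFlow.apply_zero (θ : MeasurableFlow Ω) (ω : Ω) : θ 0 ω = ω :=
  congrFun θ.zero' ω

lemma map_sub_map_sub (μ : Measure ℝ) (s t : ℝ) :
    (μ.map fun x => x - t).map (fun x => x - s) = μ.map fun x => x - (s + t) := by
  rw [Measure.map_map (by fun_prop) (by fun_prop)]
  congr 1
  ext x
  simp only [Function.comp]
  ring

lemma IsGood.flow {ω : Ω} (h : IsGood θ ξ η ω) (t : ℝ) : IsGood θ ξ η (θ t ω) where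
  left s := by rw [θ.apply_add, h.left, h.left, map_sub_map_sub]
  right s := by rw [θ.apply_add, h.right, h.right, map_sub_map_sub]
  singular := by
    rw [h.left, h.right]
    exact (MeasurableEquiv.subRight t).measurableEmbedding.mutuallySingular_map h.singular

lemma setLIntegral_map_sub (μ : Measure ℝ) (t : ℝ) (A : Set ℝ) (g : ℝ → ℝ≥0∞) :
    ∫⁻ s in A, g s ∂(μ.map fun x => x - t) = ∫⁻ s in (fun x => x - t) ⁻¹' A, g (s - t) ∂μ := by
  have he := (MeasurableEquiv.subRight t).measurableEmbedding
  have h1 : (μ.map fun x => x - t).restrict A =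
      (μ.restrict ((fun x => x - t) ⁻¹' A)).map fun x => x - t := he.restrict_map μ A
  rw [h1]
  exact he.lintegral_map _

lemma IsStationary.ae_flow (hstat : IsStationary θ P) {p : Ω → Prop} (h : ∀ᵐ ω ∂P, p ω) (t : ℝ) :
    ∀ᵐ ω ∂P, p (θ t ω) := (hstat t).quasiMeasurePreserving.ae h

/-- An event that is invariant at almost every sample point is trivial: it agrees almost
everywhere with the event that the orbit is in it at almost every time, which is strictly
invariant. -/
lemma IsErgodic.measure_eq_zero_or (herg : IsErgodic θ P) {p : Ω → Prop}
    (hp : ∀ᵐ ω ∂P, p ω) {A : Set Ω} (hA : MeasurableSet A)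
    (hinv : ∀ ω t, p ω → (θ t ω ∈ A ↔ ω ∈ A)) : P A = 0 ∨ P Aᶜ = 0 := by
  set B : Set Ω := {ω | volume {t : ℝ | θ t ω ∈ Aᶜ} = 0} with hB
  have hBm : MeasurableSet B :=
    (measurable_measure_prodMk_left (ν := (volume : Measure ℝ)) (θ.measurable' hA.compl))
      (measurableSet_singleton 0)
  have hpre : ∀ s ω, θ s ω ∈ B ↔ ω ∈ B := by
    intro s ω
    have : {t : ℝ | θ t (θ s ω) ∈ Aᶜ} = (fun t => t + s) ⁻¹' {t : ℝ | θ t ω ∈ Aᶜ} := by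
      ext t
      simp only [mem_ofPred_eq, mem_preimage, θ.apply_add]
    change volume {t : ℝ | θ t (θ s ω) ∈ Aᶜ} = 0 ↔ volume {t : ℝ | θ t ω ∈ Aᶜ} = 0
    rw [this, measure_preimage_add_right]
  have hBinv : IsInvariantSet θ B := by
    refine ⟨hBm, fun s => subset_antisymm ?_ fun ω hω => ?_⟩
    · rintro _ ⟨ω, hω, rfl⟩
      exact (hpre s ω).2 hω
    · exact ⟨θ (-s) ω, (hpre _ _).2 hω, by rw [θ.apply_add, add_neg_cancel, θ.apply_zero]⟩
  have hAB : A =ᵐ[P] B := by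
    filter_upwards [hp] with ω hω
    refine propext ?_
    change ω ∈ A ↔ volume {t : ℝ | θ t ω ∈ Aᶜ} = 0
    have hset : {t : ℝ | θ t ω ∈ Aᶜ} = {_t : ℝ | ω ∉ A} := by
      ext t
      exact not_congr (hinv ω t hω)
    rw [hset]
    by_cases h : ω ∈ A <;> simp [h]
  rcases herg B hBinv with h | h
  · exact Or.inl ((measure_congr hAB).trans h)
  · exact Or.inr ((measure_congr hAB.compl).trans h)

/-- A stationary random measure with finite intensity has almost surely no atom at `0`, so that a
half-open unit interval gives the same intensity as a closed one. -/
lemma lintegral_Icc_eq_lintegral_Ioc (hstat : IsStationary θ P)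
    (hinv : ∀ᵐ ω ∂P, ∀ t, ξ (θ t ω) = (ξ ω).map fun x => x - t) (hfin : intensity P ξ < ∞) :
    intensity P ξ = ∫⁻ ω, ξ ω (Ioc 0 1) ∂P := by
  have hshift : ∀ x : ℝ, ∫⁻ ω, ξ ω {x} ∂P = ∫⁻ ω, ξ ω {0} ∂P := by
    intro x
    rw [← (hstat x).lintegral_comp (ξ.measurable_coe (measurableSet_singleton 0))]
    refine lintegral_congr_ae ?_
    filter_upwards [hinv] with ω hω
    rw [hω x, map_sub_apply]
    congr 1
    ext y
    simp [sub_eq_zero]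
  have hzero : ∫⁻ ω, ξ ω {0} ∂P = 0 := by
    by_contra hne
    have h1 : ∑' n : ℕ, ∫⁻ ω, ξ ω {1 / ((n : ℝ) + 1)} ∂P ≤ intensity P ξ := by
      rw [← lintegral_tsum fun n => (ξ.measurable_coe (measurableSet_singleton _)).aemeasurable]
      refine lintegral_mono fun ω => ?_
      refine (tsum_meas_le_meas_iUnion_of_disjoint _ (fun n => measurableSet_singleton _)
        fun i j hij => disjoint_singleton.2 fun h => hij ?_).trans (measure_mono ?_)
      · have : (i : ℝ) + 1 = j + 1 := by simpa using h
        exact_mod_cast add_right_cancel this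
      · refine iUnion_subset fun n => singleton_subset_iff.2 ⟨by positivity, ?_⟩
        rw [div_le_one (by positivity)]
        linarith [(n.cast_nonneg : (0 : ℝ) ≤ n)]
    simp only [hshift, ENNReal.tsum_const_eq_top_of_ne_zero hne] at h1
    exact absurd hfin (not_lt.2 h1)
  refine le_antisymm ?_ (lintegral_mono fun ω => measure_mono Ioc_subset_Icc_self)
  calc intensity P ξ ≤ ∫⁻ ω, (ξ ω {0} + ξ ω (Ioc 0 1)) ∂P := by
        refine lintegral_mono fun ω => ?_
        refine (measure_mono ?_).trans (measure_union_le _ _)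
        rw [← insert_eq, Ioc_insert_left zero_le_one]
    _ = ∫⁻ ω, ξ ω (Ioc 0 1) ∂P := by
        rw [lintegral_add_left (ξ.measurable_coe (measurableSet_singleton 0)), hzero, zero_add]

/-! ### Mass transport -/

/-- The mass that `K` transports from `A` to `C`. -/
noncomputable def transported (ξ : Kernel Ω ℝ) (K : Kernel (Ω × ℝ) ℝ) (A C : Set ℝ)
    (ω : Ω) : ℝ≥0∞ :=
  ∫⁻ s in A, K (ω, s) C ∂(ξ ω)

/-- The mass in `A` that `K` leaves untransported. -/
noncomputable def escaping (ξ : Kernel Ω ℝ) (K : Kernel (Ω × ℝ) ℝ) (A : Set ℝ) (ω : Ω) : ℝ≥0∞ :=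
  ∫⁻ s in A, (1 - K (ω, s) univ) ∂(ξ ω)

/-- `K` is equivariant at `ω`: translating the sample point by the flow translates the transport. -/
def IsEquivariantAt (θ : MeasurableFlow Ω) (K : Kernel (Ω × ℝ) ℝ) (ω : Ω) : Prop :=
  ∀ (t s : ℝ) (C : Set ℝ), MeasurableSet C →
    K (θ t ω, s) C = K (ω, s + t) ((fun x => x - t) ⁻¹' C)

lemma IsGood.isEquivariantAt {ω : Ω} (h : IsGood θ ξ η ω)
    (hK : ∀ (ω : Ω) (s : ℝ) (C : Set ℝ), MeasurableSet C →
      K (ω, s) C = matchingMass (ξ ω) (η ω) s C) : IsEquivariantAt θ K ω := by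
  intro t s C hC
  have hC' : MeasurableSet ((fun x => x - t) ⁻¹' C) := (MeasurableEquiv.subRight t).measurable hC
  rw [hK _ _ _ hC, hK _ _ _ hC', h.left, h.right,
    matchingMass_map_sub_const]

lemma measurable_transported [IsSFiniteKernel ξ] {A C : Set ℝ} (hA : MeasurableSet A)
    (hC : MeasurableSet C) : Measurable (transported ξ K A C) :=
  Measurable.setLIntegral_kernel_prod_right (f := fun ω s => K (ω, s) C)
    (K.measurable_coe hC) hA

lemma measurable_escaping [IsSFiniteKernel ξ] {A : Set ℝ} (hA : MeasurableSet A) :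
    Measurable (escaping ξ K A) :=
  Measurable.setLIntegral_kernel_prod_right (f := fun ω s => 1 - K (ω, s) univ)
    ((K.measurable_coe MeasurableSet.univ).const_sub 1) hA

lemma transported_flow {ω : Ω} (hξ : ∀ t, ξ (θ t ω) = (ξ ω).map fun x => x - t)
    (hK : IsEquivariantAt θ K ω) (t : ℝ) (A : Set ℝ) {C : Set ℝ} (hC : MeasurableSet C) :
    transported ξ K A C (θ t ω) =
      transported ξ K ((fun x => x - t) ⁻¹' A) ((fun x => x - t) ⁻¹' C) ω := by
  rw [transported, hξ, setLIntegral_map_sub, transported]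
  refine lintegral_congr fun s => ?_
  rw [hK t _ C hC, sub_add_cancel]

lemma escaping_flow {ω : Ω} (hξ : ∀ t, ξ (θ t ω) = (ξ ω).map fun x => x - t)
    (hK : IsEquivariantAt θ K ω) (t : ℝ) (A : Set ℝ) :
    escaping ξ K A (θ t ω) = escaping ξ K ((fun x => x - t) ⁻¹' A) ω := by
  rw [escaping, hξ, setLIntegral_map_sub, escaping]
  refine lintegral_congr fun s => ?_
  rw [hK t _ univ MeasurableSet.univ, sub_add_cancel, preimage_univ]

lemma transported_add_escaping (hK1 : ∀ p, K p univ ≤ 1) (A : Set ℝ) (ω : Ω) :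
    transported ξ K A univ ω + escaping ξ K A ω = ξ ω A := by
  have hm : Measurable fun s => K (ω, s) univ :=
    (K.measurable_coe MeasurableSet.univ).comp measurable_prodMk_left
  rw [transported, escaping, ← lintegral_add_left hm]
  simp only [add_tsub_cancel_of_le (hK1 _), setLIntegral_one]

lemma escaping_eq_zero_iff (hK1 : ∀ p, K p univ ≤ 1) (ω : Ω) :
    escaping ξ K univ ω = 0 ↔ ∀ᵐ s ∂(ξ ω), K (ω, s) univ = 1 := by
  have hm : Measurable fun s => K (ω, s) univ :=
    (K.measurable_coe MeasurableSet.univ).comp measurable_prodMk_left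
  rw [escaping, setLIntegral_univ, lintegral_eq_zero_iff (hm.const_sub 1)]
  refine eventually_congr (Eventually.of_forall fun s => ?_)
  simp only [Pi.zero_apply, tsub_eq_zero_iff_le]
  exact ⟨fun h => le_antisymm (hK1 _) h, fun h => h.ge⟩

lemma preimage_sub_Ioc_intCast (n : ℤ) :
    (fun x : ℝ => x - n) ⁻¹' Ioc 0 1 = Ioc (n : ℝ) (n + 1) := by
  ext x
  simp only [mem_preimage, mem_Ioc]
  constructor <;> rintro ⟨h1, h2⟩ <;> constructor <;> linarith

/-- The mass-transport principle: the mass received by a unit interval has the same expectation as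
the mass sent out by it. -/
theorem lintegral_transported_eq (hstat : IsStationary θ P) [IsSFiniteKernel ξ]
    (hξ : ∀ᵐ ω ∂P, ∀ t, ξ (θ t ω) = (ξ ω).map fun x => x - t)
    (hK : ∀ᵐ ω ∂P, IsEquivariantAt θ K ω) :
    ∫⁻ ω, transported ξ K univ (Ioc 0 1) ω ∂P = ∫⁻ ω, transported ξ K (Ioc 0 1) univ ω ∂P := by
  have hU := iUnion_Ioc_intCast ℝ
  have hD := pairwise_disjoint_Ioc_intCast ℝ
  have h1 : ∀ ω, transported ξ K univ (Ioc 0 1) ω =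
      ∑' n : ℤ, transported ξ K (Ioc (n : ℝ) (n + 1)) (Ioc 0 1) ω := fun ω => by
    rw [transported, ← hU, lintegral_iUnion (fun _ => measurableSet_Ioc) hD]
    rfl
  have h2 : ∀ ω, transported ξ K (Ioc 0 1) univ ω =
      ∑' n : ℤ, transported ξ K (Ioc 0 1) (Ioc (n : ℝ) (n + 1)) ω := fun ω => by
    have hm : ∀ n : ℤ, Measurable fun s => K (ω, s) (Ioc (n : ℝ) (n + 1)) := fun n =>
      (K.measurable_coe measurableSet_Ioc).comp measurable_prodMk_left
    simp only [transported]
    rw [← lintegral_tsum fun n => (hm n).aemeasurable]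
    refine lintegral_congr fun s => ?_
    rw [← hU, measure_iUnion hD fun _ => measurableSet_Ioc]
  simp only [h1, h2]
  rw [lintegral_tsum fun n => (measurable_transported measurableSet_Ioc
    measurableSet_Ioc).aemeasurable, lintegral_tsum fun n => (measurable_transported
    measurableSet_Ioc measurableSet_Ioc).aemeasurable, ← (Equiv.neg ℤ).tsum_eq]
  refine tsum_congr fun n => ?_
  rw [← (hstat (n : ℝ)).lintegral_comp (measurable_transported measurableSet_Ioc
    measurableSet_Ioc)]
  refine lintegral_congr_ae ?_
  filter_upwards [hξ, hK] with ω hξω hKω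
  rw [transported_flow hξω hKω _ _ measurableSet_Ioc, preimage_sub_Ioc_intCast]
  simp only [Equiv.neg_apply]
  congr 1
  ext x
  simp only [mem_preimage, mem_Ioc]
  push_cast
  constructor <;> rintro ⟨h1, h2⟩ <;> constructor <;> linarith

end Flow

/-! ### The balance property -/

/-- If `M` is dominated by `N` on intervals and both agree on all unit intervals with integer
endpoints, then they agree on all intervals. -/
lemma measure_eq_of_forall_Ioc_intCast {M N : Measure ℝ} [IsLocallyFiniteMeasure N]
    (hle : ∀ a b : ℝ, a ≤ b → M (Ioc a b) ≤ N (Ioc a b))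
    (heq : ∀ n : ℤ, M (Ioc (n : ℝ) (n + 1)) = N (Ioc (n : ℝ) (n + 1))) :
    M = N := by
  have hsplit : ∀ (m : Measure ℝ) (a b c : ℝ), a ≤ b → b ≤ c →
      m (Ioc a c) = m (Ioc a b) + m (Ioc b c) := fun m a b c hab hbc => by
    rw [← Ioc_union_Ioc_eq_Ioc hab hbc, measure_union
      (Set.disjoint_left.2 fun x hx hx' => not_lt.2 hx.2 hx'.1) measurableSet_Ioc]
  have hsym : ∀ n : ℕ, M (Ioc (-(n : ℝ)) n) = N (Ioc (-(n : ℝ)) n) := by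
    intro n
    induction n with
    | zero => simp
    | succ n ih =>
      have h1 := heq n
      have h2 := heq (-(n + 1 : ℤ))
      push_cast at h1 h2 ⊢
      rw [show -((n : ℝ) + 1) + 1 = -(n : ℝ) by ring] at h2
      have hn : (0 : ℝ) ≤ n := n.cast_nonneg
      rw [hsplit M _ (-(n : ℝ)) _ (by linarith) (by linarith),
        hsplit M (-(n : ℝ)) n _ (by linarith) (by linarith),
        hsplit N _ (-(n : ℝ)) _ (by linarith) (by linarith),
        hsplit N (-(n : ℝ)) n _ (by linarith) (by linarith), h1, h2, ih]
  refine (Measure.ext_of_Ioc N M fun a b hab => ?_).symm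
  obtain ⟨n, hn⟩ := exists_nat_ge (max (-a) b)
  have ha : -(n : ℝ) ≤ a := by linarith [(le_max_left _ _).trans hn]
  have hb : b ≤ n := (le_max_right _ _).trans hn
  have h := hsym n
  rw [hsplit M _ a _ ha (hab.le.trans hb), hsplit M a b _ hab.le hb,
    hsplit N _ a _ ha (hab.le.trans hb), hsplit N a b _ hab.le hb] at h
  refine le_antisymm ?_ (hle a b hab.le)
  have h1 : N (Ioc (-(n : ℝ)) a) + (N (Ioc a b) + N (Ioc b n)) ≤
      N (Ioc (-(n : ℝ)) a) + (M (Ioc a b) + N (Ioc b n)) := by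
    rw [← h]
    exact add_le_add (hle _ _ ha) (add_le_add_right (hle _ _ hb) _)
  have h2 := (ENNReal.add_le_add_iff_left measure_Ioc_lt_top.ne).1 h1
  exact (ENNReal.add_le_add_iff_right measure_Ioc_lt_top.ne).1 h2

section Flow

variable {Ω : Type*} [MeasurableSpace Ω] {θ : MeasurableFlow Ω} {P : Measure Ω}
  {ξ η : Kernel Ω ℝ} {K : Kernel (Ω × ℝ) ℝ}

/-- The measure into which `K` transports `ξ`. -/
noncomputable def imageMeasure (ξ : Kernel Ω ℝ) (K : Kernel (Ω × ℝ) ℝ) (ω : Ω) : Measure ℝ :=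
  (ξ ω).bind fun s => K (ω, s)

lemma imageMeasure_apply (ω : Ω) {C : Set ℝ} (hC : MeasurableSet C) :
    imageMeasure ξ K ω C = ∫⁻ s, K (ω, s) C ∂(ξ ω) :=
  Measure.bind_apply hC (K.measurable.comp measurable_prodMk_left).aemeasurable

lemma imageMeasure_eq_transported (ω : Ω) {C : Set ℝ} (hC : MeasurableSet C) :
    imageMeasure ξ K ω C = transported ξ K univ C ω := by
  rw [imageMeasure_apply ω hC, transported, setLIntegral_univ]

lemma imageMeasure_flow {ω : Ω} (hξ : ∀ t, ξ (θ t ω) = (ξ ω).map fun x => x - t)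
    (hK : IsEquivariantAt θ K ω) (t : ℝ) :
    imageMeasure ξ K (θ t ω) = (imageMeasure ξ K ω).map fun x => x - t := by
  ext C hC
  have hC' : MeasurableSet ((fun x => x - t) ⁻¹' C) := (MeasurableEquiv.subRight t).measurable hC
  rw [map_sub_apply, imageMeasure_eq_transported _ hC, imageMeasure_eq_transported _ hC',
    transported_flow hξ hK _ _ hC, preimage_univ]

lemma map_sub_injective (t : ℝ) {μ ν : Measure ℝ}
    (h : (μ.map fun x => x - t) = ν.map fun x => x - t) : μ = ν := by
  have := congrArg (fun m : Measure ℝ => m.map fun x => x - (-t)) h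
  simp only [map_sub_map_sub, neg_add_cancel, sub_zero] at this
  simpa using this

/-- Unmatched mass of `ξ` and unmatched mass of `η` cannot both exist: all of the former would lie
to the right of all of the latter, so that the leftmost position of the former would be a finite
equivariant random time. Summing over the translates of the event that this time falls into a given
unit interval shows that `ξ` has finite total mass there. -/
theorem measure_eq_zero_of_escaping (hstat : IsStationary θ P) [IsSFiniteKernel ξ]
    (hξ : ∀ᵐ ω ∂P, ∀ t, ξ (θ t ω) = (ξ ω).map fun x => x - t)
    (hK : ∀ᵐ ω ∂P, IsEquivariantAt θ K ω)
    (hfin : ∫⁻ ω, ξ ω (Ioc 0 1) ∂P ≠ ∞) (hmass : ∀ᵐ ω ∂P, ξ ω univ = 0 ∨ ξ ω univ = ∞)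
    (hpos : ∀ᵐ ω ∂P, escaping ξ K univ ω ≠ 0)
    (hleft : ∀ᵐ ω ∂P, ∃ m : ℝ, escaping ξ K (Iio m) ω = 0) : P univ = 0 := by
  have hmono : ∀ ω {A B : Set ℝ}, A ⊆ B → escaping ξ K A ω ≤ escaping ξ K B ω :=
    fun ω A B h => lintegral_mono_set h
  -- `B n` is the event that the leftmost escaping mass lies in `[n, n + 1)`
  set B : ℤ → Set Ω := fun n =>
    {ω | escaping ξ K (Iio (n : ℝ)) ω = 0 ∧ escaping ξ K (Iio ((n : ℝ) + 1)) ω ≠ 0} with hB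
  have hBm : ∀ n, MeasurableSet (B n) := fun n =>
    (measurable_escaping measurableSet_Iio (measurableSet_singleton 0)).inter
      (measurable_escaping measurableSet_Iio (measurableSet_singleton 0).compl)
  have hBdisj : Pairwise (Function.onFun Disjoint B) := by
    refine (pairwise_disjoint_on B).2 fun m n hmn => Set.disjoint_left.2 fun ω hm hn => hm.2 ?_
    refine le_antisymm ((hmono ω (Iio_subset_Iio ?_)).trans_eq hn.1) zero_le
    exact_mod_cast hmn
  have hshift : ∀ᵐ ω ∂P, ∀ k n : ℤ, θ (k : ℝ) ω ∈ B n ↔ ω ∈ B (n + k) := by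
    filter_upwards [hξ, hK] with ω hξω hKω k n
    simp only [hB, mem_ofPred_eq, escaping_flow hξω hKω, preimage_sub_const_Iio]
    push_cast
    rw [add_right_comm]
  have hcover : ∀ᵐ ω ∂P, ∃ n, ω ∈ B n := by
    filter_upwards [hpos, hleft] with ω hω ⟨m, hm⟩
    by_contra! hno
    have hstep : ∀ n : ℤ, escaping ξ K (Iio (n : ℝ)) ω = 0 →
        escaping ξ K (Iio ((n : ℝ) + 1)) ω = 0 := fun n hn => by
      by_contra hne
      exact hno n ⟨hn, hne⟩
    have hfloor : escaping ξ K (Iio (⌊m⌋ : ℝ)) ω = 0 :=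
      le_antisymm ((hmono ω (Iio_subset_Iio (Int.floor_le m))).trans_eq hm) zero_le
    have hall : ∀ n : ℕ, escaping ξ K (Iio ((⌊m⌋ : ℝ) + n)) ω = 0 := by
      intro n
      induction n with
      | zero => simpa using hfloor
      | succ n ih =>
        have := hstep (⌊m⌋ + n) (by push_cast; exact ih)
        push_cast at this ⊢
        rwa [← add_assoc]
    have hU : (⋃ n : ℕ, Iio ((⌊m⌋ : ℝ) + n)) = univ := by
      refine eq_univ_of_forall fun x => mem_iUnion.2 ?_
      obtain ⟨n, hn⟩ := exists_nat_gt (x - ⌊m⌋)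
      exact ⟨n, by rw [mem_Iio]; linarith⟩
    refine hω ?_
    rw [← hU]
    suffices h : escaping ξ K (⋃ n : ℕ, Iio ((⌊m⌋ : ℝ) + n)) ω = 0 from h
    rw [escaping, setLIntegral_iUnion_of_directed]
    · exact ENNReal.iSup_eq_zero.2 hall
    · refine Monotone.directed_le fun i j hij => Iio_subset_Iio ?_
      have : (i : ℝ) ≤ j := by exact_mod_cast hij
      linarith
  -- the mass-transport step: the total mass of `ξ` on `B 0` is at most the mass in a unit interval
  have hsum : ∫⁻ ω in B 0, ξ ω univ ∂P ≤ ∫⁻ ω, ξ ω (Ioc 0 1) ∂P := by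
    have h1 : ∀ ω, ξ ω univ = ∑' n : ℤ, ξ ω (Ioc (n : ℝ) (n + 1)) := fun ω => by
      rw [← iUnion_Ioc_intCast ℝ, measure_iUnion (pairwise_disjoint_Ioc_intCast ℝ)
        fun _ => measurableSet_Ioc]
    have h2 : ∀ n : ℤ, ∫⁻ ω in B 0, ξ ω (Ioc (n : ℝ) (n + 1)) ∂P =
        ∫⁻ ω in B (-n), ξ ω (Ioc 0 1) ∂P := by
      intro n
      rw [← lintegral_indicator (hBm _), ← lintegral_indicator (hBm _),
        ← (hstat (n : ℝ)).lintegral_comp (f := (B (-n)).indicator fun ω => ξ ω (Ioc 0 1))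
          ((ξ.measurable_coe measurableSet_Ioc).indicator (hBm _))]
      refine lintegral_congr_ae ?_
      filter_upwards [hξ, hshift] with ω hξω hω
      have h3 : θ (n : ℝ) ω ∈ B (-n) ↔ ω ∈ B 0 := by
        rw [hω n (-n), neg_add_cancel]
      by_cases h : ω ∈ B 0
      · rw [indicator_of_mem h, indicator_of_mem (h3.2 h), hξω, map_sub_apply,
          preimage_sub_Ioc_intCast]
      · rw [indicator_of_notMem h, indicator_of_notMem (mt h3.1 h)]
    simp only [h1]
    rw [lintegral_tsum fun n => (ξ.measurable_coe measurableSet_Ioc).aemeasurable]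
    simp only [h2]
    have h4 : ∑' n : ℤ, ∫⁻ ω in B (-n), ξ ω (Ioc 0 1) ∂P =
        ∑' n : ℤ, ∫⁻ ω in B n, ξ ω (Ioc 0 1) ∂P :=
      (Equiv.neg ℤ).tsum_eq fun n => ∫⁻ ω in B n, ξ ω (Ioc 0 1) ∂P
    rw [h4, ← lintegral_iUnion hBm hBdisj]
    exact setLIntegral_le_lintegral _ _
  have hB0 : P (B 0) = 0 := by
    have hlt : ∀ᵐ ω ∂P.restrict (B 0), ξ ω univ < ∞ :=
      ae_lt_top (ξ.measurable_coe MeasurableSet.univ) (hsum.trans_lt (lt_top_iff_ne_top.2 hfin)).ne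
    have hlt' := (ae_restrict_iff' (hBm 0)).1 hlt
    refine measure_eq_zero_iff_ae_notMem.2 ?_
    filter_upwards [hlt', hmass] with ω h1 h2 hω
    have h3 : ξ ω = 0 := Measure.measure_univ_eq_zero.1 (h2.resolve_right (h1 hω).ne)
    refine hω.2 ?_
    rw [escaping, h3, Measure.restrict_zero, lintegral_zero_measure]
  have hBn : ∀ n, P (B n) = 0 := by
    intro n
    rw [← hB0, ← (hstat (n : ℝ)).measure_preimage (hBm 0).nullMeasurableSet]
    refine measure_congr ?_
    filter_upwards [hshift] with ω hω
    refine propext ?_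
    change ω ∈ B n ↔ θ (n : ℝ) ω ∈ B 0
    rw [hω n 0, zero_add]
  have : ∀ᵐ ω ∂P, ω ∉ ⋃ n, B n := measure_eq_zero_iff_ae_notMem.1 (measure_iUnion_null hBn)
  have hfalse : ∀ᵐ ω ∂P, False := by
    filter_upwards [this, hcover] with ω h1 ⟨n, hn⟩
    exact h1 (mem_iUnion.2 ⟨n, hn⟩)
  simpa [ae_iff] using hfalse

/-- Balance for kernels that are locally finite at every sample point. -/
theorem balances_of_locallyFinite (hstat : IsStationary θ P) (herg : IsErgodic θ P)
    [IsSFiniteKernel ξ] [IsSFiniteKernel η] (hξ : ∀ ω, IsLocallyFiniteMeasure (ξ ω))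
    (hη : ∀ ω, IsLocallyFiniteMeasure (η ω)) (hgood : ∀ᵐ ω ∂P, IsGood θ ξ η ω)
    (hint : intensity P ξ = intensity P η) (hfin : intensity P ξ < ∞)
    (hmass : ∀ᵐ ω ∂P, ξ ω univ = 0 ∨ ξ ω univ = ∞)
    (hK : ∀ (ω : Ω) (s : ℝ) (C : Set ℝ), MeasurableSet C →
      K (ω, s) C = matchingMass (ξ ω) (η ω) s C) : Balances P K ξ η := by
  have hK1 : ∀ p, K p univ ≤ 1 := fun p => by
    have h1 := hξ p.1
    have h2 := hη p.1
    rw [← Prod.mk.eta (p := p), hK _ _ _ MeasurableSet.univ]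
    exact matchingMass_le_one _ MeasurableSet.univ
  have hgξ : ∀ᵐ ω ∂P, ∀ t, ξ (θ t ω) = (ξ ω).map fun x => x - t := hgood.mono fun ω h => h.left
  have hgη : ∀ᵐ ω ∂P, ∀ t, η (θ t ω) = (η ω).map fun x => x - t := hgood.mono fun ω h => h.right
  have hgK : ∀ᵐ ω ∂P, IsEquivariantAt θ K ω := hgood.mono fun ω h => h.isEquivariantAt hK
  have hintξ := lintegral_Icc_eq_lintegral_Ioc hstat hgξ hfin
  have hintη := lintegral_Icc_eq_lintegral_Ioc hstat hgη (hint ▸ hfin)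
  have hI : ∫⁻ ω, ξ ω (Ioc 0 1) ∂P = ∫⁻ ω, η ω (Ioc 0 1) ∂P := by rw [← hintξ, hint, hintη]
  have hIfin : ∫⁻ ω, ξ ω (Ioc 0 1) ∂P ≠ ∞ := by rw [← hintξ]; exact hfin.ne
  have himage : ∀ ω a b, imageMeasure ξ K ω (Ioc a b) =
      ∫⁻ s, matchingMass (ξ ω) (η ω) s (Ioc a b) ∂(ξ ω) := fun ω a b => by
    rw [imageMeasure_apply _ measurableSet_Ioc]
    simp only [hK _ _ _ measurableSet_Ioc]
  have hle : ∀ ω, IsGood θ ξ η ω → ∀ a b : ℝ, a ≤ b →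
      imageMeasure ξ K ω (Ioc a b) ≤ η ω (Ioc a b) := fun ω hω a b hab => by
    have h1 := hξ ω
    have h2 := hη ω
    rw [himage]
    exact lintegral_matchingMass_Ioc_le hω.singular hab
  have htransport := lintegral_transported_eq hstat hgξ hgK
  have hconserve : ∫⁻ ω, transported ξ K (Ioc 0 1) univ ω ∂P +
      ∫⁻ ω, escaping ξ K (Ioc 0 1) ω ∂P = ∫⁻ ω, ξ ω (Ioc 0 1) ∂P := by
    rw [← lintegral_add_left (measurable_transported measurableSet_Ioc MeasurableSet.univ)]
    simp only [transported_add_escaping hK1]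
  -- no mass of `ξ` escapes if and only if all of `η` is used
  have hiff : (∀ᵐ ω ∂P, escaping ξ K univ ω = 0) ↔ ∀ᵐ ω ∂P, imageMeasure ξ K ω = η ω := by
    constructor
    · intro h
      have h0 : ∫⁻ ω, escaping ξ K (Ioc 0 1) ω ∂P = 0 := by
        refine (lintegral_eq_zero_iff (measurable_escaping measurableSet_Ioc)).2 ?_
        filter_upwards [h] with ω hω
        exact le_antisymm ((lintegral_mono_set (subset_univ _)).trans_eq hω) zero_le
      rw [h0, add_zero, ← htransport] at hconserve
      have hunit : ∀ᵐ ω ∂P, imageMeasure ξ K ω (Ioc 0 1) = η ω (Ioc 0 1) := by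
        have := ae_eq_of_ae_le_of_lintegral_le (μ := P)
          (f := transported ξ K univ (Ioc 0 1)) (g := fun ω => η ω (Ioc 0 1)) ?_ ?_ ?_ ?_
        · filter_upwards [this] with ω hω
          rw [imageMeasure_eq_transported _ measurableSet_Ioc]
          exact hω
        · filter_upwards [hgood] with ω hω
          rw [← imageMeasure_eq_transported _ measurableSet_Ioc]
          exact hle ω hω 0 1 zero_le_one
        · rw [hconserve]
          exact hIfin
        · exact (η.measurable_coe measurableSet_Ioc).aemeasurable
        · rw [hconserve, hI]
      have hall : ∀ᵐ ω ∂P, ∀ n : ℤ, imageMeasure ξ K (θ n ω) (Ioc 0 1) = η (θ n ω) (Ioc 0 1) :=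
        ae_all_iff.2 fun n => hstat.ae_flow hunit n
      filter_upwards [hall, hgood, hgK] with ω hω hg hKω
      have h2 := hη ω
      refine measure_eq_of_forall_Ioc_intCast (hle ω hg) fun n => ?_
      have := hω n
      rwa [imageMeasure_flow hg.left hKω, hg.right, map_sub_apply, map_sub_apply,
        preimage_sub_Ioc_intCast] at this
    · intro h
      have h1 : ∫⁻ ω, transported ξ K univ (Ioc 0 1) ω ∂P = ∫⁻ ω, η ω (Ioc 0 1) ∂P := by
        refine lintegral_congr_ae ?_
        filter_upwards [h] with ω hω
        rw [← imageMeasure_eq_transported _ measurableSet_Ioc, hω]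
      rw [← htransport, h1, ← hI] at hconserve
      have h0 : ∫⁻ ω, escaping ξ K (Ioc 0 1) ω ∂P = 0 := by
        refine (ENNReal.add_right_inj hIfin).1 ?_
        rw [hconserve, add_zero]
      have hunit := (lintegral_eq_zero_iff (measurable_escaping measurableSet_Ioc)).1 h0
      have hall : ∀ᵐ ω ∂P, ∀ n : ℤ, escaping ξ K (Ioc 0 1) (θ n ω) = 0 :=
        ae_all_iff.2 fun n => hstat.ae_flow hunit n
      filter_upwards [hall, hgξ, hgK] with ω hω hξω hKω
      rw [← iUnion_Ioc_intCast ℝ, escaping, lintegral_iUnion (fun _ => measurableSet_Ioc)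
        (pairwise_disjoint_Ioc_intCast ℝ)]
      refine ENNReal.tsum_eq_zero.2 fun n => ?_
      have := hω n
      rwa [escaping_flow hξω hKω, preimage_sub_Ioc_intCast] at this
  have hmain : ∀ᵐ ω ∂P, escaping ξ K univ ω = 0 := by
    have hz1 := herg.measure_eq_zero_or (P := P) hgood (A := {ω | escaping ξ K univ ω ≠ 0})
      (measurable_escaping MeasurableSet.univ (measurableSet_singleton 0).compl)
      (fun ω t hω => by
        simp only [mem_ofPred_eq, escaping_flow hω.left (hω.isEquivariantAt hK), preimage_univ])
    have hchar : ∀ ω, IsGood θ ξ η ω → (imageMeasure ξ K ω = η ω ↔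
        ∀ n : ℤ, transported ξ K univ (Ioc (n : ℝ) (n + 1)) ω = η ω (Ioc (n : ℝ) (n + 1))) := by
      intro ω hω
      have h2 := hη ω
      simp only [← imageMeasure_eq_transported _ measurableSet_Ioc]
      exact ⟨fun h n => by rw [h], fun h => measure_eq_of_forall_Ioc_intCast (hle ω hω) h⟩
    have hz2 := herg.measure_eq_zero_or (P := P) hgood (A := {ω | ∀ n : ℤ,
        transported ξ K univ (Ioc (n : ℝ) (n + 1)) ω = η ω (Ioc (n : ℝ) (n + 1))})
      (by
        simp only [ofPred_forall]
        exact MeasurableSet.iInter fun n => measurableSet_eq_fun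
          (measurable_transported MeasurableSet.univ measurableSet_Ioc)
          (η.measurable_coe measurableSet_Ioc))
      (fun ω t hω => by
        rw [mem_ofPred_eq, mem_ofPred_eq, ← hchar ω hω, ← hchar _ (hω.flow t),
          imageMeasure_flow hω.left (hω.isEquivariantAt hK), hω.right]
        exact ⟨map_sub_injective t, fun h => by rw [h]⟩)
    rcases hz1 with h1 | h1
    · filter_upwards [measure_eq_zero_iff_ae_notMem.1 h1] with ω hω
      simpa using hω
    rcases hz2 with h2 | h2
    swap
    · refine hiff.2 ?_
      filter_upwards [hgood, measure_eq_zero_iff_ae_notMem.1 h2] with ω hω hω2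
      exact (hchar ω hω).2 (not_not.1 hω2)
    have hP : P univ = 0 := by
      refine measure_eq_zero_of_escaping (K := K) hstat hgξ hgK hIfin hmass ?_ ?_
      · filter_upwards [measure_eq_zero_iff_ae_notMem.1 h1] with ω hω
        simpa using hω
      · filter_upwards [hgood, measure_eq_zero_iff_ae_notMem.1 h2] with ω hω hω2
        have i1 := hξ ω
        have i2 := hη ω
        by_contra! hno
        refine hω2 ((hchar ω hω).1 ?_)
        refine measure_eq_of_forall_Ioc_intCast (hle ω hω) fun n => ?_
        rw [himage]
        refine lintegral_matchingMass_Ioc_eq hω.singular le_rfl (by linarith) ?_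
        have := hno n
        simpa only [escaping, hK _ _ _ MeasurableSet.univ] using this
    rw [Measure.measure_univ_eq_zero.1 hP]
    exact ae_zero ▸ eventually_bot
  refine ⟨hmain.mono fun ω hω => (escaping_eq_zero_iff hK1 ω).1 hω, ?_⟩
  filter_upwards [hiff.1 hmain] with ω hω C hC
  rw [← imageMeasure_apply ω hC, hω]

end Flow

/-! ### Restriction to the locally finite sample points -/

section Flow

variable {Ω : Type*} [MeasurableSpace Ω]

lemma FiniteOnCompacts.map_sub {μ : Measure ℝ} (h : FiniteOnCompacts μ) (t : ℝ) :
    FiniteOnCompacts (μ.map fun x => x - t) := by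
  intro C hC
  rw [map_sub_apply]
  exact h _ ((Homeomorph.subRight t).isCompact_preimage.2 hC)

lemma IsInvariantKernel.ae_eq_map {θ : MeasurableFlow Ω} {P : Measure Ω} {ξ : Kernel Ω ℝ}
    (h : IsInvariantKernel θ P ξ) : ∀ᵐ ω ∂P, ∀ t, ξ (θ t ω) = (ξ ω).map fun x => x - t := by
  filter_upwards [h] with ω hω t
  ext C hC
  have hC' : MeasurableSet ((fun x => x - t) ⁻¹' C) := (MeasurableEquiv.subRight t).measurable hC
  rw [map_sub_apply, ← hω t _ hC',
    image_preimage_eq C (show Function.Surjective fun x : ℝ => x - t from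
      (MeasurableEquiv.subRight t).surjective)]

end Flow

end RandomTransport

theorem theorem3p2 {Ω : Type*} [MeasurableSpace Ω] (P : MeasureTheory.Measure Ω)
    [MeasureTheory.SigmaFinite P] (θ : RandomTransport.MeasurableFlow Ω)
    (hstat : RandomTransport.IsStationary θ P) (herg : RandomTransport.IsErgodic θ P)
    (ξ η : ProbabilityTheory.Kernel Ω ℝ)
    (hξ : RandomTransport.IsRandomMeasure P ξ) (hη : RandomTransport.IsRandomMeasure P η)
    (hξinv : RandomTransport.IsInvariantKernel θ P ξ)
    (hηinv : RandomTransport.IsInvariantKernel θ P η)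
    (hsing : RandomTransport.AEMutuallySingular P ξ η)
    (hint : RandomTransport.intensity P ξ = RandomTransport.intensity P η)
    (hfin : RandomTransport.intensity P ξ < ∞)
    -- automatic when `P` is finite; excludes translations of a fixed finite measure
    (hmass : ∀ᵐ ω ∂P, ξ ω Set.univ = 0 ∨ ξ ω Set.univ = ∞) :
    ∃ K : ProbabilityTheory.Kernel (Ω × ℝ) ℝ,
      (∀ ω : Ω, RandomTransport.FiniteOnCompacts (ξ ω) →
        RandomTransport.FiniteOnCompacts (η ω) →
        ∀ (s : ℝ) (C : Set ℝ), MeasurableSet C →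
          K (ω, s) C = RandomTransport.matchingMass (ξ ω) (η ω) s C) ∧
      RandomTransport.IsTransportKernel K ∧
      RandomTransport.Balances P K ξ η := by
  classical
  -- both kernels are set to `0` at the sample points where one of them is not locally finite
  set G : Set Ω := {ω | RandomTransport.FiniteOnCompacts (ξ ω)} ∩
    {ω | RandomTransport.FiniteOnCompacts (η ω)} with hG
  have hGm : MeasurableSet G := (RandomTransport.measurableSet_finiteOnCompacts ξ).inter
    (RandomTransport.measurableSet_finiteOnCompacts η)
  have hGae : ∀ᵐ ω ∂P, ω ∈ G := by
    filter_upwards [hξ, hη] with ω h1 h2 using ⟨h1, h2⟩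
  set ξ' : Kernel Ω ℝ := Kernel.piecewise hGm ξ 0 with hξ'
  set η' : Kernel Ω ℝ := Kernel.piecewise hGm η 0 with hη'
  have hξG : ∀ ω ∈ G, ξ' ω = ξ ω := fun ω hω => by rw [hξ', Kernel.piecewise_apply, if_pos hω]
  have hηG : ∀ ω ∈ G, η' ω = η ω := fun ω hω => by rw [hη', Kernel.piecewise_apply, if_pos hω]
  have hξ'loc : ∀ ω, IsLocallyFiniteMeasure (ξ' ω) := fun ω => by
    rw [hξ', Kernel.piecewise_apply]
    split_ifs with h
    · exact h.1.isLocallyFiniteMeasure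
    · rw [zero_apply]
      infer_instance
  have hη'loc : ∀ ω, IsLocallyFiniteMeasure (η' ω) := fun ω => by
    rw [hη', Kernel.piecewise_apply]
    split_ifs with h
    · exact h.2.isLocallyFiniteMeasure
    · rw [zero_apply]
      infer_instance
  have i1 := RandomTransport.isSFiniteKernel_of_isLocallyFiniteMeasure ξ' hξ'loc
  have i2 := RandomTransport.isSFiniteKernel_of_isLocallyFiniteMeasure η' hη'loc
  obtain ⟨K, hK⟩ := RandomTransport.exists_matchingKernel ξ' η' hη'loc
  have hgood : ∀ᵐ ω ∂P, RandomTransport.IsGood θ ξ' η' ω := by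
    filter_upwards [hGae, hξinv.ae_eq_map, hηinv.ae_eq_map, hsing] with ω hω h1 h2 h3
    have hflow : ∀ t, θ t ω ∈ G := fun t => by
      refine ⟨?_, ?_⟩
      · change RandomTransport.FiniteOnCompacts (ξ (θ t ω))
        rw [h1 t]
        exact hω.1.map_sub t
      · change RandomTransport.FiniteOnCompacts (η (θ t ω))
        rw [h2 t]
        exact hω.2.map_sub t
    refine ⟨fun t => ?_, fun t => ?_, ?_⟩
    · rw [hξG _ (hflow t), hξG _ hω, h1]
    · rw [hηG _ (hflow t), hηG _ hω, h2]
    · rwa [hξG _ hω, hηG _ hω]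
  have hintξ : RandomTransport.intensity P ξ' = RandomTransport.intensity P ξ :=
    lintegral_congr_ae (hGae.mono fun ω hω => by simp only [hξG ω hω])
  have hintη : RandomTransport.intensity P η' = RandomTransport.intensity P η :=
    lintegral_congr_ae (hGae.mono fun ω hω => by simp only [hηG ω hω])
  have hbal : RandomTransport.Balances P K ξ' η' :=
    RandomTransport.balances_of_locallyFinite hstat herg hξ'loc hη'loc hgood
      (by rw [hintξ, hintη, hint]) (by rwa [hintξ])
      (by filter_upwards [hGae, hmass] with ω hω h; rwa [hξG ω hω]) hK
  refine ⟨K, fun ω h1 h2 s C hC => ?_, fun p => ?_, ?_, ?_⟩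
  · rw [hK ω s C hC, hξG ω ⟨h1, h2⟩, hηG ω ⟨h1, h2⟩]
  · have j1 := hξ'loc p.1
    have j2 := hη'loc p.1
    rw [← Prod.mk.eta (p := p), hK _ _ _ MeasurableSet.univ]
    exact RandomTransport.matchingMass_le_one _ MeasurableSet.univ
  · filter_upwards [hbal.1, hGae] with ω h hω
    rwa [hξG ω hω] at h
  · filter_upwards [hbal.2, hGae] with ω h hω
    rwa [hξG ω hω, hηG ω hω] at h
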